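/- **Theorem 1.** Let $G=(V,E)$ be a finite graph (parallel edges allowed) with edge costs $c_e\ge 0$ and let $\mathcal F$ be a family of subsets of $V$. For $J\subseteq E$ and $S\subseteq V$ let $d_J(S)$ be the number of edges in $J$ with exactly one end in $S$; $J$ *covers* $S$ if $d_J(S)\ge 1$, and $J$ covers $\mathcal F$ if it covers every $S\in\mathcal F$. *Set Family Edge Cover* asks for a minimum-cost $J\subseteq E$ that covers $\mathcal F$; assume that $E$ covers $\mathcal F$ (in particular $\emptyset,V\notin\mathcal F$). For $I\subseteq E$ let $\mathcal F^I=\{S\in\mathcal F: d_I(S)=0\}$, and call the inclusion-minimal members of a family its *cores*. Two sets $A,B$ *cross* if $A\cap B$, $V\setminus(A\cup B)$, $A\setminus B$, $B\setminus A$ are all non-empty. Suppose that $\mathcal F$ is *$\gamma$-pliable*, that is: * for all $A,B\in\mathcal F$, at least two of $A\cap B$, $A\cup B$, $A\setminus B$, $B\setminus A$ (counted as four expressions) belong to $\mathcal F$; and * for every $I\subseteq E$ and all $S_1\subsetneq S_2$ in $\mathcal F^I$, if a core $C$ of $\mathcal F^I$ crosses each of $S_1,S_2$, then $S_2\setminus(S_1\cup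 C)$ is either empty or a member of $\mathcal F^I$. The primal-dual algorithm of Williamson, Goemans, Mihail and Vazirani works with the dual linear program: maximize $\sum_{S\in\mathcal F}y_S$ subject to $y\ge 0$ and $\sum_{S\in\mathcal F:\,e\text{ covers }S}y_S\le c_e$ for every $e\in E$. An edge is *tight* if its constraint holds with equality. *Phase 1* starts with $I=\emptyset$, $y=0$. While $\mathcal F^I$ has a core, it raises the dual variables of all cores of $\mathcal F^I$ uniformly (possibly by zero) until some edge $e\in E\setminus I$ becomes tight, no edge of $E\setminus I$ exceeding its cost, and adds $e$ to $I$. *Phase 2* considers the edges of $I$ in the reverse of the order in which they were added, and deletes each one whose removal leaves a cover of $\mathcal F$. Then: 1. However ties are broken, every completed run of the algorithm ends with a cover $J$ of $\mathcal F$ and a feasible dual solution $y$ such that $$\sum_{e\in J}c_e\le 10\sum_{S\in\mathcal F}y_S ,$$ and consequently $\sum_{e\in J}c_e\le 10\sum_{e\in J'}c_e$ for every $J'\subseteq E$ that covers $\mathcal F$. 2. Given an oracle that, for any $I\subseteq E$, lists the cores of $\mathcal F^I$, a complete run of the algorithm can be carried out deterministically in a number of elementary steps that is polynomial in $|V|+|E|$.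 (The elementary steps are those of a random access machine that adds, subtracts and compares integers and costs and divides costs by integers; an oracle call is charged for the sizes of its question and answer.) Hence Set Family Edge Cover with a $\gamma$-pliable family admits approximation ratio $10$ in polynomial time. -/

import Mathlib

namespace FamilyCover

/-! ### The covering problem -/

/-- A graph with vertex set `V`, edge set `E` (parallel edges are allowed) and nonnegative edge
costs.  The edge `e` joins `tail e` and `head e`; which end is called the tail is immaterial. -/
structure Network (V E : Type*) where
  tail : E → V
  head : E → V
  cost : E → ℝ
  cost_nonneg : ∀ e, 0 ≤ cost e

section

variable {V E : Type*} [Fintype V] [DecidableEq V] [Fintype E] [DecidableEq E]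

/-- The edge `e` has exactly one end in `S`. -/
abbrev Network.Covers (N : Network V E) (e : E) (S : Finset V) : Prop :=
  ¬ (N.tail e ∈ S ↔ N.head e ∈ S)

/-- The set of edges of `J` with exactly one end in `S`. -/
def Network.cut (N : Network V E) (J : Finset E) (S : Finset V) : Finset E :=
  J.filter fun e => N.Covers e S

/-- The edge set `J` covers every member of `F`. -/
abbrev Network.CoversFamily (N : Network V E) (F : Finset (Finset V)) (J : Finset E) : Prop :=
  ∀ S ∈ F, 1 ≤ (N.cut J S).card

/-- The total cost of an edge set. -/
def Network.totalCost (N : Network V E) (J : Finset E) : ℝ :=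
  ∑ e ∈ J, N.cost e

/-- The residual family: the members of `F` that are not covered by `I`. -/
def Network.residual (N : Network V E) (F : Finset (Finset V)) (I : Finset E) :
    Finset (Finset V) :=
  F.filter fun S => (N.cut I S).card = 0

/-- The cores of a family: its inclusion-minimal members. -/
def cores (F : Finset (Finset V)) : Finset (Finset V) :=
  F.filter fun C => ∀ S ∈ F, S ⊆ C → S = C

/-- `A` and `B` cross. -/
def Cross (A B : Finset V) : Prop :=
  (A ∩ B).Nonempty ∧ (A ∪ B)ᶜ.Nonempty ∧ (A \ B).Nonempty ∧ (B \ A).Nonempty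

/-- For `A, B ∈ F`, at least two of the four sets `A ∩ B`, `A ∪ B`, `A \ B`, `B \ A` are in `F`
(counted as four expressions, so that `A = B` imposes nothing). -/
def Pliable (F : Finset (Finset V)) : Prop :=
  ∀ A ∈ F, ∀ B ∈ F,
    2 ≤ ([A ∩ B, A ∪ B, A \ B, B \ A].filter (fun X => X ∈ F)).length

/-- Property (γ).  The edge sets `I` range over the subsets of the edge set of the network; this
is the weakest version of the property, since letting `I` use further edges on `V` would only add
requirements. -/
def Network.PropertyGamma (N : Network V E) (F : Finset (Finset V)) : Prop :=
  ∀ (I : Finset E), ∀ S₁ ∈ N.residual F I, ∀ S₂ ∈ N.residual F I, S₁ ⊂ S₂ →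
    ∀ C ∈ cores (N.residual F I), Cross C S₁ → Cross C S₂ →
      S₂ \ (S₁ ∪ C) = ∅ ∨ S₂ \ (S₁ ∪ C) ∈ N.residual F I

/-- `F` is γ-pliable. -/
def Network.GammaPliable (N : Network V E) (F : Finset (Finset V)) : Prop :=
  Pliable F ∧ N.PropertyGamma F

/-! ### The dual linear program -/

/-- The left-hand side of the dual constraint of the edge `e`. -/
def Network.load (N : Network V E) (F : Finset (Finset V)) (y : Finset V → ℝ) (e : E) : ℝ :=
  ∑ S ∈ F.filter (fun S => N.Covers e S), y S

/-- The dual constraint of `e` holds with equality. -/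
def Network.Tight (N : Network V E) (F : Finset (Finset V)) (y : Finset V → ℝ) (e : E) : Prop :=
  N.load F y e = N.cost e

/-- `y` is a feasible solution of the dual program (only its values on `F` matter). -/
def Network.DualFeasible (N : Network V E) (F : Finset (Finset V)) (y : Finset V → ℝ) : Prop :=
  (∀ S ∈ F, 0 ≤ y S) ∧ ∀ e, N.load F y e ≤ N.cost e

/-- The dual objective value. -/
def dualValue (F : Finset (Finset V)) (y : Finset V → ℝ) : ℝ :=
  ∑ S ∈ F, y S

/-! ### The primal-dual algorithm with reverse delete -/

/-- Raise the dual variables of the members of `Cs` uniformly by `ε`. -/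
def raise (y : Finset V → ℝ) (Cs : Finset (Finset V)) (ε : ℝ) : Finset V → ℝ :=
  fun S => y S + if S ∈ Cs then ε else 0

/-- `Phase1 N F l y`: after some number of iterations of the first phase, with some way of breaking
ties, `l` lists the edges added so far, the most recent one first, and `y` is the current dual
vector.  In an iteration the dual variables of the cores of the residual family are raised uniformly
until an edge `e` outside the current edge set becomes tight: `ε` is the first moment of the raise
at which `e` is tight, and up to then no edge outside the current edge set has exceeded its cost.
Then `e` is added. -/
inductive Phase1 (N : Network V E) (F : Finset (Finset V)) :
    List E → (Finset V → ℝ) → Prop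
  | start : Phase1 N F [] (fun _ => 0)
  | step (l : List E) (y : Finset V → ℝ) (e : E) (ε : ℝ)
      (before : Phase1 N F l y)
      (uncovered : (cores (N.residual F l.toFinset)).Nonempty)
      (new_edge : e ∉ l)
      (nonneg : 0 ≤ ε)
      (no_excess : ∀ f, f ∉ l →
        N.load F (raise y (cores (N.residual F l.toFinset)) ε) f ≤ N.cost f)
      (tight : N.Tight F (raise y (cores (N.residual F l.toFinset)) ε) e)
      (first : ∀ ε', 0 ≤ ε' → ε' < ε →
        ¬ N.Tight F (raise y (cores (N.residual F l.toFinset)) ε') e) :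
      Phase1 N F (e :: l) (raise y (cores (N.residual F l.toFinset)) ε)

/-- The second phase: go through the edges from the most recently added one to the first one, and
delete an edge if the remaining edges still cover `F`. -/
def Network.reverseDelete (N : Network V E) (F : Finset (Finset V)) (l : List E) : Finset E :=
  l.foldl (fun I e => if N.CoversFamily F (I.erase e) then I.erase e else I) l.toFinset

/-- `J` is the edge set and `y` the dual vector at the end of a complete run of the algorithm. -/
def Network.AlgorithmResult (N : Network V E) (F : Finset (Finset V)) (J : Finset E)
    (y : Finset V → ℝ) : Prop :=
  ∃ l : List E, Phase1 N F l y ∧ cores (N.residual F l.toFinset) = ∅ ∧ J = N.reverseDelete F l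

end

/-! ### The machine model

A random access machine with two-dimensional arrays of natural numbers and of real numbers.  The
programs are finite.  In one step a program evaluates an expression of fixed size and stores the
value, or evaluates a test.  Natural numbers can only be added, subtracted and compared; real
numbers can only be added, subtracted, compared, and divided by a natural number; and no real
constants occur in programs.  So within `t` steps a natural number gets at most polynomially many
(in `t`) bits more than the input, and so do the numerators and denominators of the "real" numbers
if the input costs are rational: polynomially many steps mean polynomial time in the bit model. -/

/-- Names of the arrays of natural numbers.  An integer variable is the entry `0, 0` of an array. -/
inductive NatArray where
  | numVertices
  | numEdges
  | tail
  | head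
  | query
  | numCores
  | core
  | output
  | work (k : ℕ)
  deriving DecidableEq

/-- Names of the arrays of real numbers. -/
inductive RealArray where
  | cost
  | work (k : ℕ)
  deriving DecidableEq

/-- The memory of the machine. -/
structure Store where
  nat : NatArray → ℕ → ℕ → ℕ
  real : RealArray → ℕ → ℕ → ℝ

/-- Natural number expressions. -/
inductive NatExpr where
  | const (k : ℕ)
  | read (a : NatArray) (i j : NatExpr)
  | add (x y : NatExpr)
  | sub (x y : NatExpr)

/-- Real expressions; `divNat x k` is `x / k`. -/
inductive RealExpr where
  | zero
  | read (a : RealArray) (i j : NatExpr)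
  | add (x y : RealExpr)
  | sub (x y : RealExpr)
  | divNat (x : RealExpr) (k : NatExpr)

/-- Tests. -/
inductive Test where
  | natLt (x y : NatExpr)
  | natEq (x y : NatExpr)
  | realLt (x y : RealExpr)
  | neg (b : Test)
  | conj (b c : Test)

/-- Programs. -/
inductive Program where
  | skip
  | setNat (a : NatArray) (i j x : NatExpr)
  | setReal (a : RealArray) (i j : NatExpr) (x : RealExpr)
  | seq (P Q : Program)
  | ite (b : Test) (P Q : Program)
  | loop (b : Test) (P : Program)
  | askCores

def NatExpr.eval (s : Store) : NatExpr → ℕ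
  | const k => k
  | read a i j => s.nat a (i.eval s) (j.eval s)
  | add x y => x.eval s + y.eval s
  | sub x y => x.eval s - y.eval s

noncomputable def RealExpr.eval (s : Store) : RealExpr → ℝ
  | zero => 0
  | read a i j => s.real a (i.eval s) (j.eval s)
  | add x y => x.eval s + y.eval s
  | sub x y => x.eval s - y.eval s
  | divNat x k => x.eval s / (k.eval s : ℝ)

def Test.holds (s : Store) : Test → Prop
  | natLt x y => x.eval s < y.eval s
  | natEq x y => x.eval s = y.eval s
  | realLt x y => x.eval s < y.eval s
  | neg b => ¬ b.holds s
  | conj b c => b.holds s ∧ c.holds s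

def Store.setNat (s : Store) (a : NatArray) (i j x : ℕ) : Store where
  nat a' i' j' := if a' = a ∧ i' = i ∧ j' = j then x else s.nat a' i' j'
  real := s.real

def Store.setReal (s : Store) (a : RealArray) (i j : ℕ) (x : ℝ) : Store where
  nat := s.nat
  real a' i' j' := if a' = a ∧ i' = i ∧ j' = j then x else s.real a' i' j'

/-- The edge set whose indicator vector is stored in an array. -/
def Store.edgeSet (s : Store) (m : ℕ) (a : NatArray) : Finset (Fin m) :=
  Finset.univ.filter fun e => s.nat a e 0 ≠ 0

/-- A list of vertex sets is written to the memory: their number, and for every set in the list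
its indicator vector. -/
def Store.writeCores {n : ℕ} (s : Store) (L : List (Finset (Fin n))) : Store where
  nat a i j :=
    if a = NatArray.numCores ∧ i = 0 ∧ j = 0 then L.length
    else if h : a = NatArray.core ∧ i < L.length ∧ j < n then
      (if (⟨j, h.2.2⟩ : Fin n) ∈ L[i]'h.2.1 then 1 else 0)
    else s.nat a i j
  real := s.real

/-- An oracle that lists, for every edge set `I`, the cores of the residual family of `I`, in some
order. -/
def Network.CoreOracle {n m : ℕ} (N : Network (Fin n) (Fin m)) (F : Finset (Finset (Fin n)))
    (oracle : Finset (Fin m) → List (Finset (Fin n))) : Prop :=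
  ∀ I, (oracle I).Nodup ∧ (oracle I).toFinset = cores (N.residual F I)

/-- `Runs oracle P s s' t`: started with memory `s`, the program `P` halts with memory `s'` after
`t` steps.  A call of the oracle is charged for the sizes of the question and of the answer. -/
inductive Runs {n m : ℕ} (oracle : Finset (Fin m) → List (Finset (Fin n))) :
    Program → Store → Store → ℕ → Prop
  | skip (s : Store) : Runs oracle .skip s s 1
  | setNat (s : Store) (a : NatArray) (i j x : NatExpr) :
      Runs oracle (.setNat a i j x) s (s.setNat a (i.eval s) (j.eval s) (x.eval s)) 1
  | setReal (s : Store) (a : RealArray) (i j : NatExpr) (x : RealExpr) :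
      Runs oracle (.setReal a i j x) s (s.setReal a (i.eval s) (j.eval s) (x.eval s)) 1
  | seq (P Q : Program) (s s' s'' : Store) (t t' : ℕ)
      (first : Runs oracle P s s' t) (second : Runs oracle Q s' s'' t') :
      Runs oracle (.seq P Q) s s'' (t + t')
  | iteTrue (b : Test) (P Q : Program) (s s' : Store) (t : ℕ)
      (test : b.holds s) (branch : Runs oracle P s s' t) :
      Runs oracle (.ite b P Q) s s' (t + 1)
  | iteFalse (b : Test) (P Q : Program) (s s' : Store) (t : ℕ)
      (test : ¬ b.holds s) (branch : Runs oracle Q s s' t) :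
      Runs oracle (.ite b P Q) s s' (t + 1)
  | loopDone (b : Test) (P : Program) (s : Store)
      (test : ¬ b.holds s) :
      Runs oracle (.loop b P) s s 1
  | loopMore (b : Test) (P : Program) (s s' s'' : Store) (t t' : ℕ)
      (test : b.holds s) (body : Runs oracle P s s' t)
      (rest : Runs oracle (.loop b P) s' s'' t') :
      Runs oracle (.loop b P) s s'' (t + t' + 1)
  | askCores (s : Store) :
      Runs oracle .askCores s (s.writeCores (oracle (s.edgeSet m .query)))
        (1 + m + n * (oracle (s.edgeSet m .query)).length)

/-- The machine is deterministic. -/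
theorem Runs.deterministic {n m : ℕ} {oracle : Finset (Fin m) → List (Finset (Fin n))}
    {P : Program} {s s₁ : Store} {t₁ : ℕ} (h₁ : Runs oracle P s s₁ t₁) :
    ∀ {s₂ : Store} {t₂ : ℕ}, Runs oracle P s s₂ t₂ → s₁ = s₂ ∧ t₁ = t₂ := by
  induction h₁ with
  | skip | setNat | setReal | askCores => intro s₂ t₂ h; cases h; exact ⟨rfl, rfl⟩
  | seq P Q s s' s'' t t' _ _ ih₁ ih₂ =>
    intro s₂ t₂ h
    cases h with
    | seq _ _ _ r' _ u u' g₁ g₂ =>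
      obtain ⟨rfl, rfl⟩ := ih₁ g₁
      obtain ⟨rfl, rfl⟩ := ih₂ g₂
      exact ⟨rfl, rfl⟩
  | iteTrue b P Q s s' t hb _ ih =>
    intro s₂ t₂ h
    cases h with
    | iteTrue _ _ _ _ _ _ _ g => obtain ⟨rfl, rfl⟩ := ih g; exact ⟨rfl, rfl⟩
    | iteFalse _ _ _ _ _ _ hb' _ => exact absurd hb hb'
  | iteFalse b P Q s s' t hb _ ih =>
    intro s₂ t₂ h
    cases h with
    | iteTrue _ _ _ _ _ _ hb' _ => exact absurd hb' hb
    | iteFalse _ _ _ _ _ _ _ g => obtain ⟨rfl, rfl⟩ := ih g; exact ⟨rfl, rfl⟩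
  | loopDone b P s hb =>
    intro s₂ t₂ h
    cases h with
    | loopDone => exact ⟨rfl, rfl⟩
    | loopMore _ _ _ _ _ _ _ hb' => exact absurd hb' hb
  | loopMore b P s s' s'' t t' hb _ _ ih₁ ih₂ =>
    intro s₂ t₂ h
    cases h with
    | loopDone _ _ _ hb' => exact absurd hb hb'
    | loopMore _ _ _ r' _ u u' _ g₁ g₂ =>
      obtain ⟨rfl, rfl⟩ := ih₁ g₁
      obtain ⟨rfl, rfl⟩ := ih₂ g₂
      exact ⟨rfl, rfl⟩

/-- The initial memory: the numbers of vertices and edges, the ends of the edges, and the costs.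
All other entries are zero.  The set family is accessible through the oracle only. -/
def Network.initialStore {n m : ℕ} (N : Network (Fin n) (Fin m)) : Store where
  nat a i j :=
    match a with
    | .numVertices => if i = 0 ∧ j = 0 then n else 0
    | .numEdges => if i = 0 ∧ j = 0 then m else 0
    | .tail => if h : i < m ∧ j = 0 then (N.tail ⟨i, h.1⟩ : ℕ) else 0
    | .head => if h : i < m ∧ j = 0 then (N.head ⟨i, h.1⟩ : ℕ) else 0
    | _ => 0
  real a i j :=
    match a with
    | .cost => if h : i < m ∧ j = 0 then N.cost ⟨i, h.1⟩ else 0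
    | .work _ => 0

end FamilyCover

/-! Every selected edge is tight, so the cost of the final cover `J` equals the sum of y_S d_J(S).
An iteration that raises the cores by ε adds ε times the sum of their degrees in `J` to this sum and
ε times their number to the dual value. The ratio 10 therefore follows once the core degrees are at
most 10 on average (`Network.sum_cut_cores_le`). Reverse delete provides the needed minimality: at
each iteration, every edge of `J` not yet selected is the only edge of `J` covering some set of the
residual family (`exists_witness_of_mem_reverseDelete`).

Pliability lets such witness sets be uncrossed into a laminar family (`exists_laminar_witnesses`).
With the whole vertex set as root this is a tree, and the edges of `J` correspond to the tree edges:
`e` joins the layer of `w e` (the vertices whose least containing node is `w e`) to the layer of its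
parent. Call a node special if it is the root, the hull of a core, or has two children. Every leaf
is the hull of a core, so with k cores fewer than 2k members of the family are special
(`Laminar.card_special_lt`).

The other nodes form paths, each above a special base. Property (γ) controls such a path: a core
meeting one of its layers contains every higher layer of the path (`layer_subset_core`), since
otherwise a core would lie in a layer difference that contains none. Because distinct cores are
disjoint, only boundedly many ends of edges along a path can lie in a core that misses the other
end. Sorting these ends into five types makes the pair (type, base) injective (`card_counted_le`),
so the degrees sum to at most 5(2k - 1) < 10k.

For the running time, pairwise disjoint nonempty cores number at most n, and an iteration amounts to
choosing an uncovered edge of least slack per covered core (`Phase1.step_of_ratio`). The program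
stores only the edge loads; the dual vector itself appears only in the correctness proof. -/

namespace FamilyCover

set_option linter.unusedSectionVars false

section

variable {V E : Type*} [Fintype V] [DecidableEq V] [Fintype E] [DecidableEq E]

/-! ### Laminar families of witness sets -/

/-- `A` and `B` intersect, and neither contains the other. -/
def Overlap (A B : Finset V) : Prop :=
  ¬ Disjoint A B ∧ ¬ A ⊆ B ∧ ¬ B ⊆ A

theorem Overlap.symm {A B : Finset V} (h : Overlap A B) : Overlap B A :=
  ⟨fun h' => h.1 h'.symm, h.2.2, h.2.1⟩

/-- `D` is one of the four sets obtained by uncrossing `A` and `B`. -/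
def IsCorner (A B D : Finset V) : Prop :=
  D = A ∩ B ∨ D = A ∪ B ∨ D = A \ B ∨ D = B \ A

theorem not_overlap_corner {A B D : Finset V} (hAB : Overlap A B) (hD : IsCorner A B D) :
    ¬ Overlap A D ∧ ¬ Overlap B D := by
  simp only [Overlap, Finset.disjoint_left, Finset.subset_iff] at *
  rcases hD with rfl | rfl | rfl | rfl <;> grind

/-- This is what makes uncrossing terminate: replacing a set by a corner creates no overlap with a
set that overlapped neither original. -/
theorem Overlap.of_corner {A B D Y : Finset V} (hAB : Overlap A B) (hD : IsCorner A B D)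
    (hY : Overlap Y D) : Overlap Y A ∨ Overlap Y B := by
  by_contra hc
  push Not at hc
  have laminar_cases : ∀ {X Z : Finset V}, ¬ Overlap X Z → Disjoint X Z ∨ X ⊆ Z ∨ Z ⊆ X := by
    intro X Z h
    simp only [Overlap] at h
    tauto
  obtain ⟨h1, h2⟩ := hc
  obtain ⟨hAB1, hAB2, hAB3⟩ := hAB
  obtain ⟨hY1, hY2, hY3⟩ := hY
  rcases laminar_cases h1 with h1 | h1 | h1 <;> rcases laminar_cases h2 with h2 | h2 | h2 <;>
  rcases hD with rfl | rfl | rfl | rfl <;>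
  clear laminar_cases <;> simp only [Finset.disjoint_left, Finset.subset_iff] at * <;> grind

theorem Pliable.two_corners {H : Finset (Finset V)} (hH : Pliable H) {A B : Finset V}
    (hA : A ∈ H) (hB : B ∈ H) :
    (A ∩ B ∈ H ∧ A ∪ B ∈ H) ∨ (A ∩ B ∈ H ∧ A \ B ∈ H) ∨ (A ∩ B ∈ H ∧ B \ A ∈ H) ∨
    (A ∪ B ∈ H ∧ A \ B ∈ H) ∨ (A ∪ B ∈ H ∧ B \ A ∈ H) ∨ (A \ B ∈ H ∧ B \ A ∈ H) := by
  have h := hH A hA B hB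
  simp only [List.filter_cons, List.filter_nil] at h
  by_cases h1 : A ∩ B ∈ H <;> by_cases h2 : A ∪ B ∈ H <;> by_cases h3 : A \ B ∈ H <;>
    by_cases h4 : B \ A ∈ H <;> simp_all

/-- `e` is the only edge of `J` that covers the member `S` of `H`. -/
def Network.IsWitness (N : Network V E) (H : Finset (Finset V)) (J : Finset E) (e : E)
    (S : Finset V) : Prop :=
  S ∈ H ∧ ∀ g ∈ J, N.Covers g S ↔ g = e

/-- No edge of `J` other than `e` and `f` covers a corner. According to the sides on which `e` and
`f` lie, one corner is covered by neither, one by both, one by `e` only and one by `f` only. The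
first is not in `H`, so two of the other three are, and one of these has a single covering edge.
Where the corner for `f` lies depends only on the side of `B` containing `e`. -/
theorem Network.IsWitness.uncross {N : Network V E} {H : Finset (Finset V)} {J : Finset E}
    (hH : Pliable H) (hJ : ∀ S ∈ H, ∃ g ∈ J, N.Covers g S) {e f : E} (he : e ∈ J) (hf : f ∈ J)
    (hef : e ≠ f) {A B : Finset V} (hA : N.IsWitness H J e A) (hB : N.IsWitness H J f B) :
    (∃ D, IsCorner A B D ∧ N.IsWitness H J e D) ∨
    (N.tail e ∉ B ∧ ∃ D, (D = A ∩ B ∨ D = B \ A) ∧ N.IsWitness H J f D) ∨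
    (N.tail e ∈ B ∧ ∃ D, (D = A \ B ∨ D = A ∪ B) ∧ N.IsWitness H J f D) := by
  obtain ⟨hAH, hA⟩ := hA
  obtain ⟨hBH, hB⟩ := hB
  have corners := hH.two_corners hAH hBH
  have eA := hA e he
  have eB := hB e he
  have fA := hA f hf
  have fB := hB f hf
  have rest : ∀ g ∈ J, g ≠ e → g ≠ f →
      (N.tail g ∈ A ↔ N.head g ∈ A) ∧ (N.tail g ∈ B ↔ N.head g ∈ B) := by
    intro g hg h1 h2
    have hgA := hA g hg
    have hgB := hB g hg
    simp only [Network.Covers, h1, h2, iff_false, not_not] at hgA hgB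
    exact ⟨hgA, hgB⟩
  have key : ∀ D, IsCorner A B D → ∀ g ∈ J, g ≠ e → g ≠ f → ¬ N.Covers g D := by
    intro D hD g hg h1 h2
    obtain ⟨r1, r2⟩ := rest g hg h1 h2
    rcases hD with rfl | rfl | rfl | rfl <;> simp [Network.Covers, r1, r2]
  have only_e : ∀ D, IsCorner A B D → D ∈ H → N.Covers e D → ¬ N.Covers f D →
      N.IsWitness H J e D := by
    refine fun D hD hDH h1 h2 => ⟨hDH, fun g hg => ?_⟩
    by_cases h3 : g = e
    · subst h3; simpa using h1
    · by_cases h4 : g = f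
      · subst h4; simp only [h3, iff_false]; exact h2
      · simp only [h3, iff_false]; exact key D hD g hg h3 h4
  have only_f : ∀ D, IsCorner A B D → D ∈ H → N.Covers f D → ¬ N.Covers e D →
      N.IsWitness H J f D := by
    refine fun D hD hDH h1 h2 => ⟨hDH, fun g hg => ?_⟩
    by_cases h3 : g = f
    · subst h3; simpa using h1
    · by_cases h4 : g = e
      · subst h4; simp only [h3, iff_false]; exact h2
      · simp only [h3, iff_false]; exact key D hD g hg h4 h3
  have some_edge : ∀ D, IsCorner A B D → D ∈ H → N.Covers e D ∨ N.Covers f D := by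
    intro D hD hDH
    obtain ⟨g, hg, hgD⟩ := hJ D hDH
    by_cases h3 : g = e
    · exact .inl (h3 ▸ hgD)
    · by_cases h4 : g = f
      · exact .inr (h4 ▸ hgD)
      · exact absurd hgD (key D hD g hg h3 h4)
  have c1 : IsCorner A B (A ∩ B) := .inl rfl
  have c2 : IsCorner A B (A ∪ B) := .inr (.inl rfl)
  have c3 : IsCorner A B (A \ B) := .inr (.inr (.inl rfl))
  have c4 : IsCorner A B (B \ A) := .inr (.inr (.inr rfl))
  simp only [Network.Covers, iff_true, hef, hef.symm, iff_false, not_not] at eA eB fA fB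
  -- Both ends of `e` are on the same side of `B`, so `tail e` alone decides which two corners `e`
  -- covers.
  have ce : (N.Covers e (A ∩ B) ↔ N.tail e ∈ B) ∧ (N.Covers e (A ∪ B) ↔ N.tail e ∉ B) ∧
      (N.Covers e (A \ B) ↔ N.tail e ∉ B) ∧ (N.Covers e (B \ A) ↔ N.tail e ∈ B) := by
    simp only [Network.Covers, Finset.mem_inter, Finset.mem_union, Finset.mem_sdiff, ← eB]
    clear * - eA
    by_cases h : N.tail e ∈ A <;> by_cases h' : N.head e ∈ A <;> simp_all
  have cf : (N.Covers f (A ∩ B) ↔ N.tail f ∈ A) ∧ (N.Covers f (A ∪ B) ↔ N.tail f ∉ A) ∧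
      (N.Covers f (A \ B) ↔ N.tail f ∈ A) ∧ (N.Covers f (B \ A) ↔ N.tail f ∉ A) := by
    simp only [Network.Covers, Finset.mem_inter, Finset.mem_union, Finset.mem_sdiff, ← fA]
    clear * - fB
    by_cases h : N.tail f ∈ B <;> by_cases h' : N.head f ∈ B <;> simp_all
  obtain ⟨e1, e2, e3, e4⟩ := ce
  obtain ⟨f1, f2, f3, f4⟩ := cf
  have s1 := some_edge _ c1
  have s2 := some_edge _ c2
  have s3 := some_edge _ c3
  have s4 := some_edge _ c4
  rw [e1, f1] at s1
  rw [e2, f2] at s2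
  rw [e3, f3] at s3
  rw [e4, f4] at s4
  by_cases he' : N.tail e ∈ B <;> by_cases hf' : N.tail f ∈ A
  · have n2 : A ∪ B ∉ H := fun h => by simp [he', hf'] at s2; exact s2 h
    by_cases m4 : B \ A ∈ H
    · exact .inl ⟨_, c4, only_e _ c4 m4 (e4.2 he') (mt f4.1 (not_not.2 hf'))⟩
    · have m3 : A \ B ∈ H := by clear * - corners n2 m4; tauto
      exact .inr (.inr ⟨he', _, .inl rfl, only_f _ c3 m3 (f3.2 hf') (mt e3.1 (not_not.2 he'))⟩)
  · have n3 : A \ B ∉ H := fun h => by simp [he', hf'] at s3; exact s3 h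
    by_cases m1 : A ∩ B ∈ H
    · exact .inl ⟨_, c1, only_e _ c1 m1 (e1.2 he') (mt f1.1 hf')⟩
    · have m2 : A ∪ B ∈ H := by clear * - corners n3 m1; tauto
      exact .inr (.inr ⟨he', _, .inr rfl, only_f _ c2 m2 (f2.2 hf') (mt e2.1 (not_not.2 he'))⟩)
  · have n4 : B \ A ∉ H := fun h => by simp [he', hf'] at s4; exact s4 h
    by_cases m2 : A ∪ B ∈ H
    · exact .inl ⟨_, c2, only_e _ c2 m2 (e2.2 he') (mt f2.1 (not_not.2 hf'))⟩
    · have m1 : A ∩ B ∈ H := by clear * - corners n4 m2; tauto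
      exact .inr (.inl ⟨he', _, .inl rfl, only_f _ c1 m1 (f1.2 hf') (mt e1.1 he')⟩)
  · have n1 : A ∩ B ∉ H := fun h => by simp [he', hf'] at s1; exact s1 h
    by_cases m3 : A \ B ∈ H
    · exact .inl ⟨_, c3, only_e _ c3 m3 (e3.2 he') (mt f3.1 hf')⟩
    · have m4 : B \ A ∈ H := by clear * - corners n1 m3; tauto
      exact .inr (.inl ⟨he', _, .inr rfl, only_f _ c4 m4 (f4.2 hf') (mt e4.1 he')⟩)

/-- Edges are inserted one at a time. The new witness set is uncrossed against a laminar family, by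
induction on the number of sets it overlaps; either it or one old set is replaced by a corner. -/
theorem exists_laminar_witnesses {N : Network V E} {H : Finset (Finset V)} {J : Finset E}
    (hH : Pliable H) (hJ : ∀ S ∈ H, ∃ g ∈ J, N.Covers g S)
    (hmin : ∀ e ∈ J, ∃ S, N.IsWitness H J e S) :
    ∃ w : E → Finset V, (∀ e ∈ J, N.IsWitness H J e (w e)) ∧
      ∀ e ∈ J, ∀ f ∈ J, ¬ Overlap (w e) (w f) := by
  classical
  suffices h : ∀ T ⊆ J, ∃ w : E → Finset V, (∀ e ∈ T, N.IsWitness H J e (w e)) ∧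
      ∀ e ∈ T, ∀ f ∈ T, ¬ Overlap (w e) (w f) from h J subset_rfl
  intro T
  induction T using Finset.induction_on with
  | empty => exact fun _ => ⟨fun _ => ∅, by simp, by simp⟩
  | insert e T heT ih =>
    intro hT
    have heJ : e ∈ J := hT (Finset.mem_insert_self _ _)
    have hTJ : T ⊆ J := (Finset.subset_insert _ _).trans hT
    -- the witness families for `T` together with a witness set for `e`
    have main : ∀ k, ∀ (w : E → Finset V) (S : Finset V), (∀ f ∈ T, N.IsWitness H J f (w f)) →
        (∀ f ∈ T, ∀ g ∈ T, ¬ Overlap (w f) (w g)) → N.IsWitness H J e S →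
        (T.filter fun f => Overlap S (w f)).card = k →
        ∃ (w' : E → Finset V) (S' : Finset V), (∀ f ∈ T, N.IsWitness H J f (w' f)) ∧
          (∀ f ∈ T, ∀ g ∈ T, ¬ Overlap (w' f) (w' g)) ∧ N.IsWitness H J e S' ∧
          ∀ f ∈ T, ¬ Overlap S' (w' f) := by
      intro k
      induction k using Nat.strong_induction_on with
      | _ k ihk =>
      intro w S hw hlam hS hk
      by_cases h0 : ∀ f ∈ T, ¬ Overlap S (w f)
      · exact ⟨w, S, hw, hlam, hS, h0⟩
      push Not at h0
      -- Replacing `S` by a corner is always safe: the old sets are mutually laminar, so any set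
      -- overlapping the corner already overlapped `S`.
      by_cases hrep : ∃ f ∈ T, Overlap S (w f) ∧
          ∃ D, IsCorner S (w f) D ∧ N.IsWitness H J e D
      · obtain ⟨f, hf, hov, D, hD, hDw⟩ := hrep
        refine ihk _ ?_ w D hw hlam hDw rfl
        rw [← hk]
        apply Finset.card_lt_card
        rw [Finset.ssubset_iff_of_subset]
        · refine ⟨f, by simp [hf, hov], ?_⟩
          simp only [Finset.mem_filter, hf, true_and]
          exact fun h => (not_overlap_corner hov hD).2 h.symm
        · intro g hg
          simp only [Finset.mem_filter] at hg ⊢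
          refine ⟨hg.1, ?_⟩
          rcases hov.of_corner hD hg.2.symm with h | h
          · exact h.symm
          · exact absurd h (hlam g hg.1 f hf)
      · push Not at hrep
        have unc : ∀ f ∈ T, Overlap S (w f) →
            (N.tail e ∉ w f ∧ ∃ D, (D = S ∩ w f ∨ D = w f \ S) ∧ N.IsWitness H J f D) ∨
            (N.tail e ∈ w f ∧ ∃ D, (D = S \ w f ∨ D = S ∪ w f) ∧ N.IsWitness H J f D) := by
          intro f hf hov
          refine (hS.uncross hH hJ heJ (hTJ hf) (fun h => heT (h ▸ hf)) (hw f hf)).resolve_left ?_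
          rintro ⟨D, hD, hDw⟩
          exact hrep f hf hov D hD hDw
        -- Replacing an old set could spoil laminarity of the old family, so `f` must be chosen such
        -- that its corner overlaps no old set.
        suffices hX : ∃ f ∈ T, Overlap S (w f) ∧ ∃ D, IsCorner S (w f) D ∧ N.IsWitness H J f D ∧
            ∀ g ∈ T, ¬ Overlap (w g) D by
          obtain ⟨f, hf, hov, D, hD, hDw, hDlam⟩ := hX
          have hself : ¬ Overlap D D := fun h => h.2.1 subset_rfl
          refine ihk _ ?_ (Function.update w f D) S ?_ ?_ hS rfl
          · rw [← hk]
            apply Finset.card_lt_card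
            rw [Finset.ssubset_iff_of_subset]
            · refine ⟨f, by simp [hf, hov], ?_⟩
              simp only [Finset.mem_filter, hf, true_and, Function.update_self]
              exact (not_overlap_corner hov hD).1
            · intro g hg
              simp only [Finset.mem_filter] at hg ⊢
              refine ⟨hg.1, ?_⟩
              by_cases hgf : g = f
              · subst hgf; exact hov
              · simpa [Function.update_of_ne hgf] using hg.2
          · intro g hg
            by_cases hgf : g = f
            · subst hgf; simpa using hDw
            · simpa [Function.update_of_ne hgf] using hw g hg
          · intro g hg g' hg'
            by_cases hgf : g = f <;> by_cases hgf' : g' = f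
            · subst hgf hgf'; simpa using hself
            · subst hgf; rw [Function.update_self, Function.update_of_ne hgf']
              exact fun h => hDlam g' hg' h.symm
            · subst hgf'; rw [Function.update_self, Function.update_of_ne hgf]
              exact hDlam g hg
            · rw [Function.update_of_ne hgf', Function.update_of_ne hgf]
              exact hlam g hg g' hg'
        -- If some overlapping set avoids `e`, a smallest one works: its corner lies inside it, and
        -- a set overlapping the corner would be a smaller candidate.
        by_cases hout : ∃ f ∈ T, Overlap S (w f) ∧ N.tail e ∉ w f
        · obtain ⟨f, hf, hfmin⟩ := Finset.exists_min_image
            (T.filter fun f => Overlap S (w f) ∧ N.tail e ∉ w f) (fun f => (w f).card)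
            (by simpa [Finset.Nonempty] using hout)
          simp only [Finset.mem_filter] at hf hfmin
          obtain ⟨hfT, hov, hef⟩ := hf
          obtain ⟨D, hD, hDw⟩ := ((unc f hfT hov).resolve_right fun h => hef h.1).2
          have hDc : IsCorner S (w f) D := by
            rcases hD with h | h
            · exact .inl h
            · exact .inr (.inr (.inr h))
          refine ⟨f, hfT, hov, D, hDc, hDw, fun g hg hgD => ?_⟩
          have hDf : D ⊆ w f := by
            rcases hD with rfl | rfl
            · exact Finset.inter_subset_right
            · exact Finset.sdiff_subset
          have hgS : Overlap (w g) S := (hov.of_corner hDc hgD).resolve_right (hlam g hg f hfT)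
          have hgf : w g ⊆ w f := by
            by_contra hn
            refine hlam g hg f hfT ⟨fun h => hgD.1 (h.mono_right hDf), hn, fun h => hgD.2.2 ?_⟩
            exact hDf.trans h
          have := hfmin g ⟨hg, hgS.symm, fun h => hef (hgf h)⟩
          have heq := Finset.eq_of_subset_of_card_le hgf this
          rw [heq] at hgD
          exact hgD.2.2 hDf
        · push Not at hout
          -- Now all overlapping sets contain `tail e`, hence form a chain. The largest one contains
          -- all the others, which are thus disjoint from `S \ w f` and contained in `S ∪ w f`.
          obtain ⟨f, hf, hfmax⟩ := Finset.exists_max_image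
            (T.filter fun f => Overlap S (w f)) (fun f => (w f).card)
            (by simpa [Finset.Nonempty] using h0)
          simp only [Finset.mem_filter] at hf hfmax
          obtain ⟨hfT, hov⟩ := hf
          obtain ⟨D, hD, hDw⟩ := ((unc f hfT hov).resolve_left fun h => h.1 (hout f hfT hov)).2
          have hDc : IsCorner S (w f) D := by
            rcases hD with h | h
            · exact .inr (.inr (.inl h))
            · exact .inr (.inl h)
          refine ⟨f, hfT, hov, D, hDc, hDw, fun g hg hgD => ?_⟩
          have hgS : Overlap (w g) S := (hov.of_corner hDc hgD).resolve_right (hlam g hg f hfT)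
          have hge := hout g hg hgS.symm
          have hfe := hout f hfT hov
          have hgf : w g ⊆ w f := by
            by_contra hn
            have h1 : w f ⊆ w g := by
              by_contra h2
              exact hlam g hg f hfT ⟨Finset.not_disjoint_iff.2 ⟨_, hge, hfe⟩, hn, h2⟩
            exact hn (Finset.eq_of_subset_of_card_le h1 (hfmax g ⟨hg, hgS.symm⟩)).ge
          rcases hD with rfl | rfl
          · exact hgD.1 (Finset.disjoint_sdiff.mono_left hgf)
          · exact hgD.2.1 (hgf.trans Finset.subset_union_right)
    obtain ⟨w₀, hw₀, hlam₀⟩ := ih hTJ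
    obtain ⟨S₀, hS₀⟩ := hmin e heJ
    obtain ⟨w, S, hw, hlam, hS, hSw⟩ := main _ w₀ S₀ hw₀ hlam₀ hS₀ rfl
    have hself : ¬ Overlap S S := fun h => h.2.1 subset_rfl
    have hne : ∀ f ∈ T, Function.update w e S f = w f := fun f hf =>
      Function.update_of_ne (by rintro rfl; exact heT hf) _ _
    refine ⟨Function.update w e S, ?_, ?_⟩
    · intro f hf
      rcases Finset.mem_insert.1 hf with rfl | hf
      · simpa using hS
      · rw [hne f hf]; exact hw f hf
    · intro f hf g hg
      rcases Finset.mem_insert.1 hf with hf | hf <;> rcases Finset.mem_insert.1 hg with hg | hg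
      · simpa [hf, hg] using hself
      · rw [hf, hne g hg, Function.update_self]; exact hSw g hg
      · rw [hg, hne f hf, Function.update_self]; exact fun h => hSw f hf h.symm
      · rw [hne f hf, hne g hg]; exact hlam f hf g hg

end

section

variable {V E : Type*} [Fintype V] [DecidableEq V] [Fintype E] [DecidableEq E]

/-! ### Cores of pliable families -/

theorem mem_cores {H : Finset (Finset V)} {C : Finset V} :
    C ∈ cores H ↔ C ∈ H ∧ ∀ S ∈ H, S ⊆ C → S = C := by
  simp [cores]

theorem exists_core_subset {H : Finset (Finset V)} {S : Finset V} (hS : S ∈ H) :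
    ∃ C ∈ cores H, C ⊆ S := by
  obtain ⟨C, hC, hmin⟩ := Finset.exists_min_image (H.filter (· ⊆ S)) Finset.card
    ⟨S, by simp [hS]⟩
  simp only [Finset.mem_filter] at hC hmin
  exact ⟨C, mem_cores.2 ⟨hC.1, fun T hT hTC =>
    Finset.eq_of_subset_of_card_le hTC (hmin T ⟨hT, hTC.trans hC.2⟩)⟩, hC.2⟩

/-- If two distinct cores met, the intersection and both differences would violate minimality,
leaving only the union where pliability demands two sets. -/
theorem Pliable.disjoint_cores {H : Finset (Finset V)} (hH : Pliable H) {C D : Finset V}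
    (hC : C ∈ cores H) (hD : D ∈ cores H) (hCD : C ≠ D) : Disjoint C D := by
  rw [mem_cores] at hC hD
  by_contra hdis
  have h1 : C ∩ D ∉ H := fun h => by
    have e1 := hC.2 _ h Finset.inter_subset_left
    have e2 := hD.2 _ h Finset.inter_subset_right
    exact hCD (e1.symm.trans e2)
  have h2 : C \ D ∉ H := fun h =>
    hdis (Finset.sdiff_eq_self_iff_disjoint.1 (hC.2 _ h Finset.sdiff_subset))
  have h3 : D \ C ∉ H := fun h =>
    hdis (Finset.sdiff_eq_self_iff_disjoint.1 (hD.2 _ h Finset.sdiff_subset)).symm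
  have := hH.two_corners hC.1 hD.1
  tauto

/-- If `C` meets `S` without being contained in it, minimality excludes `C ∩ S` and `C \ S`. Hence
the union is a member, so it is not everything. -/
theorem Pliable.core_cases {H : Finset (Finset V)} (hH : Pliable H) (huniv : Finset.univ ∉ H)
    {C S : Finset V} (hC : C ∈ cores H) (hS : S ∈ H) : Disjoint C S ∨ C ⊆ S ∨ Cross C S := by
  rw [mem_cores] at hC
  by_contra hcon
  push Not at hcon
  obtain ⟨hdis, hsub, hcross⟩ := hcon
  have h1 : C ∩ S ∉ H := fun h =>
    hsub (Finset.inter_eq_left.1 (hC.2 _ h Finset.inter_subset_left))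
  have h2 : C \ S ∉ H := fun h =>
    hdis (Finset.sdiff_eq_self_iff_disjoint.1 (hC.2 _ h Finset.sdiff_subset))
  have h3 : C ∪ S ∈ H := by
    have := hH.two_corners hC.1 hS
    tauto
  refine hcross ⟨?_, ?_, ?_, ?_⟩
  · exact Finset.not_disjoint_iff_nonempty_inter.1 hdis
  · rw [Finset.nonempty_iff_ne_empty, Ne, Finset.compl_eq_empty_iff]
    intro h; exact huniv (h ▸ h3)
  · exact Finset.sdiff_nonempty.2 hsub
  · refine Finset.sdiff_nonempty.2 fun h => ?_
    exact hsub (hC.2 _ hS h).ge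

/-! ### The tree of a laminar family -/

/-- The least member of `L`, if there is one, that contains `X`; otherwise the whole vertex set. -/
def hull (L : Finset (Finset V)) (X : Finset V) : Finset V :=
  (L.filter (X ⊆ ·)).inf id

/-- The least member of `L`, if there is one, that properly contains `X`; otherwise the whole
vertex set. -/
def parent (L : Finset (Finset V)) (X : Finset V) : Finset V :=
  (L.filter (X ⊂ ·)).inf id

/-- No two members of `L` overlap. -/
def Laminar (L : Finset (Finset V)) : Prop :=
  ∀ A ∈ L, ∀ B ∈ L, ¬ Overlap A B

theorem Laminar.cases {L : Finset (Finset V)} (hL : Laminar L) {A B : Finset V} (hA : A ∈ L)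
    (hB : B ∈ L) {v : V} (hvA : v ∈ A) (hvB : v ∈ B) : A ⊆ B ∨ B ⊆ A := by
  have h := hL A hA B hB
  by_contra hc
  push Not at hc
  exact h ⟨Finset.not_disjoint_iff.2 ⟨v, hvA, hvB⟩, hc⟩

theorem inf_mem_of_chain {K : Finset (Finset V)} (hK : K.Nonempty)
    (hchain : ∀ A ∈ K, ∀ B ∈ K, A ⊆ B ∨ B ⊆ A) : K.inf id ∈ K := by
  obtain ⟨A, hA, hmin⟩ := Finset.exists_min_image K Finset.card hK
  have : K.inf id = A := by
    apply le_antisymm (Finset.inf_le hA)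
    refine Finset.le_inf fun B hB => ?_
    rcases hchain A hA B hB with h | h
    · exact h
    · exact (Finset.eq_of_subset_of_card_le h (hmin B hB)).ge
  rwa [this]

theorem subset_hull (L : Finset (Finset V)) (X : Finset V) : X ⊆ hull L X :=
  Finset.le_inf fun B hB => by simp only [Finset.mem_filter] at hB; exact hB.2

theorem hull_subset {L : Finset (Finset V)} {X B : Finset V} (hB : B ∈ L) (hX : X ⊆ B) :
    hull L X ⊆ B :=
  Finset.inf_le (f := id) (by simp [hB, hX])

theorem Laminar.hull_mem {L : Finset (Finset V)} (hL : Laminar L) {X B : Finset V}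
    (hX : X.Nonempty) (hB : B ∈ L) (hXB : X ⊆ B) : hull L X ∈ L := by
  obtain ⟨v, hv⟩ := hX
  refine (Finset.mem_filter.1 (inf_mem_of_chain (K := L.filter (X ⊆ ·)) ⟨B, by simp [hB, hXB]⟩
    fun A hA B hB => ?_)).1
  simp only [Finset.mem_filter] at hA hB
  exact hL.cases hA.1 hB.1 (hA.2 hv) (hB.2 hv)

theorem parent_subset {L : Finset (Finset V)} {X B : Finset V} (hB : B ∈ L) (hX : X ⊂ B) :
    parent L X ⊆ B :=
  Finset.inf_le (f := id) (by simp [hB, hX])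

theorem Laminar.parent_mem {L : Finset (Finset V)} (hL : Laminar L) {X B : Finset V}
    (hX : X.Nonempty) (hB : B ∈ L) (hXB : X ⊂ B) : parent L X ∈ L ∧ X ⊂ parent L X := by
  obtain ⟨v, hv⟩ := hX
  refine Finset.mem_filter.1 (inf_mem_of_chain (K := L.filter (X ⊂ ·)) ⟨B, by simp [hB, hXB]⟩
    fun A hA B hB => ?_)
  simp only [Finset.mem_filter] at hA hB
  exact hL.cases hA.1 hB.1 (hA.2.subset hv) (hB.2.subset hv)

theorem Laminar.parent_mem_insert {L : Finset (Finset V)} (hL : Laminar L) {X : Finset V}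
    (hX : X.Nonempty) : parent L X ∈ insert Finset.univ L := by
  by_cases h : ∃ B ∈ L, X ⊂ B
  · obtain ⟨B, hB, hXB⟩ := h
    exact Finset.mem_insert_of_mem (hL.parent_mem hX hB hXB).1
  · have : L.filter (X ⊂ ·) = ∅ := by
      push Not at h
      exact Finset.filter_eq_empty_iff.2 h
    simp [parent, this]

/-- A largest member between `Y` and `X` is a child of `X`. Adjoining `Finset.univ` as a root turns
the forest into a tree. -/
theorem Laminar.exists_child {L : Finset (Finset V)} (hL : Laminar L) {X Y : Finset V}
    (hX : X ∈ insert Finset.univ L) (hY : Y ∈ L) (hYne : Y.Nonempty) (hYX : Y ⊂ X) :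
    ∃ Z ∈ L, Y ⊆ Z ∧ Z ⊂ X ∧ parent L Z = X := by
  obtain ⟨Z, hZ, hmax⟩ := Finset.exists_max_image (L.filter fun Z => Y ⊆ Z ∧ Z ⊂ X) Finset.card
    ⟨Y, by simp [hY, hYX]⟩
  simp only [Finset.mem_filter] at hZ hmax
  obtain ⟨hZL, hYZ, hZX⟩ := hZ
  have hZne : Z.Nonempty := hYne.mono hYZ
  refine ⟨Z, hZL, hYZ, hZX, ?_⟩
  by_cases h : ∃ B ∈ L, Z ⊂ B
  · obtain ⟨B, hB, hZB⟩ := h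
    obtain ⟨hp, hZp⟩ := hL.parent_mem hZne hB hZB
    have hpX : parent L Z ⊆ X := by
      rcases Finset.mem_insert.1 hX with rfl | hX
      · exact Finset.subset_univ _
      · exact parent_subset hX hZX
    by_contra hne
    have := hmax _ ⟨hp, hYZ.trans hZp.subset, hpX.ssubset_of_ne hne⟩
    exact absurd (Finset.card_lt_card hZp) (not_lt.2 this)
  · have hp : L.filter (Z ⊂ ·) = ∅ := by
      push Not at h
      exact Finset.filter_eq_empty_iff.2 h
    rcases Finset.mem_insert.1 hX with rfl | hX
    · simp [parent, hp]
    · exact absurd ⟨X, hX, hZX⟩ h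

/-- The nodes of the tree of `L` that are the root, the hull of a core, or have two children. -/
def Special (L Cs : Finset (Finset V)) (X : Finset V) : Prop :=
  X = Finset.univ ∨ (∃ C ∈ Cs, hull L C = X) ∨ 2 ≤ (L.filter (parent L · = X)).card

open Classical in
-- In a tree the branching nodes are fewer than the leaves, and each leaf is the hull of a core.
-- Hulls and branching nodes together thus number at most twice the cores, minus one.
theorem Laminar.card_special_lt {L Cs : Finset (Finset V)} (hL : Laminar L)
    (hne : L.Nonempty) (hmem : ∀ X ∈ L, X.Nonempty) (huniv : Finset.univ ∉ L)
    (hCs : ∀ X ∈ L, ∃ C ∈ Cs, C.Nonempty ∧ C ⊆ X) :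
    (L.filter (Special L Cs)).card < 2 * Cs.card := by
  set nodes := insert Finset.univ L with hnodes
  set ch : Finset V → ℕ := fun X => (L.filter (parent L · = X)).card with hch
  have hsum : L.card = ∑ X ∈ nodes, ch X :=
    Finset.card_eq_sum_card_fiberwise fun X hX => hL.parent_mem_insert (hmem X hX)
  have hcard : nodes.card = L.card + 1 := Finset.card_insert_of_notMem huniv
  have hleaf : (nodes.filter (ch · = 0)) ⊆ Cs.image (hull L) := by
    intro X hX
    simp only [Finset.mem_filter] at hX
    obtain ⟨hX, h0⟩ := hX
    have nochild : ∀ Y ∈ L, ¬ Y ⊂ X := fun Y hY hYX => by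
      obtain ⟨Z, hZ, -, -, hZp⟩ := hL.exists_child hX hY (hmem Y hY) hYX
      rw [hch, Finset.card_eq_zero, Finset.filter_eq_empty_iff] at h0
      exact h0 hZ hZp
    rcases Finset.mem_insert.1 hX with rfl | hXL
    · obtain ⟨Y, hY⟩ := hne
      exact absurd ((Finset.subset_univ Y).ssubset_of_ne fun h => huniv (h ▸ hY)) (nochild Y hY)
    · obtain ⟨C, hC, hCne, hCX⟩ := hCs X hXL
      refine Finset.mem_image.2 ⟨C, hC, ?_⟩
      by_contra h
      exact nochild _ (hL.hull_mem hCne hXL hCX) ((hull_subset hXL hCX).ssubset_of_ne h)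
  have hbranch : (nodes.filter (2 ≤ ch ·)).card + 1 ≤ (nodes.filter (ch · = 0)).card := by
    -- Summed over the nodes, the numbers of children give `L.card`, one less than the number of
    -- nodes; this is the source of the strict inequality.
    have h : ∑ X ∈ nodes, (1 + if 2 ≤ ch X then 1 else 0) ≤
        ∑ X ∈ nodes, (ch X + if ch X = 0 then 1 else 0) := by
      refine Finset.sum_le_sum fun X _ => ?_
      split_ifs <;> omega
    rw [Finset.sum_add_distrib, Finset.sum_add_distrib, ← hsum, ← Finset.card_filter,
      ← Finset.card_filter] at h
    simp only [Finset.sum_const, smul_eq_mul, mul_one] at h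
    omega
  have hspecial : L.filter (Special L Cs) ⊆
      Cs.image (hull L) ∪ nodes.filter (2 ≤ ch ·) := by
    intro X hX
    simp only [Finset.mem_filter] at hX
    obtain ⟨hX, h | ⟨C, hC, h⟩ | h⟩ := hX
    · exact absurd (h ▸ hX) huniv
    · exact Finset.mem_union_left _ (Finset.mem_image.2 ⟨C, hC, h⟩)
    · exact Finset.mem_union_right _
        (Finset.mem_filter.2 ⟨Finset.mem_insert_of_mem hX, h⟩)
  have h1 := Finset.card_le_card hspecial
  have h2 := Finset.card_union_le (Cs.image (hull L)) (nodes.filter (2 ≤ ch ·))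
  have h3 : (Cs.image (hull L)).card ≤ Cs.card := Finset.card_image_le
  have h4 := Finset.card_le_card hleaf
  omega

/-! ### Minimal covers with a laminar family of witness sets -/

/-- `J` is a cover of the pliable family `H` that satisfies property (γ), and `w` chooses witness
sets for the edges of `J` that form a laminar family. -/
structure Network.LaminarCover (N : Network V E) (H : Finset (Finset V)) (J : Finset E)
    (w : E → Finset V) : Prop where
  pliable : Pliable H
  gamma : ∀ S₁ ∈ H, ∀ S₂ ∈ H, S₁ ⊂ S₂ → ∀ C ∈ cores H, Cross C S₁ → Cross C S₂ →
    S₂ \ (S₁ ∪ C) = ∅ ∨ S₂ \ (S₁ ∪ C) ∈ H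
  covered : ∀ S ∈ H, ∃ g ∈ J, N.Covers g S
  witness : ∀ e ∈ J, N.IsWitness H J e (w e)
  laminar : Laminar (J.image w)

/-- The end of `e` in `w e` (for `true`) or the other end (for `false`), for an edge `e` that
covers `w e`. -/
def Network.endpoint (N : Network V E) (w : E → Finset V) (e : E) (b : Bool) : V :=
  if (N.tail e ∈ w e ↔ b) then N.tail e else N.head e

namespace Network.LaminarCover

variable {N : Network V E} {H : Finset (Finset V)} {J : Finset E} {w : E → Finset V}

theorem empty_notMem (h : N.LaminarCover H J w) : ∅ ∉ H := fun h0 => by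
  obtain ⟨g, -, hg⟩ := h.covered _ h0
  simp [Network.Covers] at hg

theorem univ_notMem (h : N.LaminarCover H J w) : Finset.univ ∉ H := fun h0 => by
  obtain ⟨g, -, hg⟩ := h.covered _ h0
  simp [Network.Covers] at hg

theorem nonempty (h : N.LaminarCover H J w) {S : Finset V} (hS : S ∈ H) : S.Nonempty :=
  Finset.nonempty_iff_ne_empty.2 fun h0 => h.empty_notMem (h0 ▸ hS)

theorem mem_of_mem_image (h : N.LaminarCover H J w) {S : Finset V} (hS : S ∈ J.image w) :
    S ∈ H := by
  obtain ⟨e, he, rfl⟩ := Finset.mem_image.1 hS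
  exact (h.witness e he).1

theorem endpoint_mem (h : N.LaminarCover H J w) {e : E} (he : e ∈ J) (b : Bool) :
    N.endpoint w e b ∈ w e ↔ b := by
  have h1 := ((h.witness e he).2 e he).2 rfl
  unfold Network.endpoint
  cases b <;> simp only [Network.Covers] at h1 ⊢ <;> split_ifs <;> simp_all

theorem covers_iff_endpoint {e : E} (X : Finset V) :
    N.Covers e X ↔ ¬ (N.endpoint w e true ∈ X ↔ N.endpoint w e false ∈ X) := by
  unfold Network.endpoint
  by_cases h1 : N.tail e ∈ w e
  · simp [h1, Network.Covers]
  · simp [h1, Network.Covers, iff_comm]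

theorem endpoint_mem_iff (h : N.LaminarCover H J w) {e f : E} (he : e ∈ J) (hf : f ∈ J)
    (hfe : f ≠ e) : N.endpoint w e true ∈ w f ↔ N.endpoint w e false ∈ w f := by
  have := (h.witness f hf).2 e he
  rw [covers_iff_endpoint (w := w)] at this
  by_contra hc
  exact hfe (this.1 hc).symm

theorem injOn (h : N.LaminarCover H J w) : Set.InjOn w J := fun e he f hf hef => by
  have h1 := (h.witness e he).2 e he
  rw [hef] at h1
  exact ((h.witness f hf).2 e he).1 (h1.2 rfl)

/-- Only `w e` separates the ends of `e`. A smaller member containing the inner end would also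
contain the outer end, which is outside `w e`. -/
theorem hull_endpoint_true (h : N.LaminarCover H J w) {e : E} (he : e ∈ J) :
    hull (J.image w) {N.endpoint w e true} = w e := by
  have hmem : N.endpoint w e true ∈ w e := (h.endpoint_mem he true).2 rfl
  apply subset_antisymm
  · exact hull_subset (Finset.mem_image_of_mem w he) (by simpa using hmem)
  · refine Finset.le_inf fun B hB => ?_
    simp only [Finset.mem_filter, Finset.singleton_subset_iff] at hB
    obtain ⟨hBL, hB⟩ := hB
    refine (h.laminar.cases (Finset.mem_image_of_mem w he) hBL hmem hB).elim id fun hsub => ?_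
    obtain ⟨f, hf, rfl⟩ := Finset.mem_image.1 hBL
    by_cases hfe : f = e
    · rw [hfe]; rfl
    · have := (h.endpoint_mem_iff he hf hfe).1 hB
      exact absurd ((h.endpoint_mem he false).1 (hsub this)) (by simp)

/-- With the previous lemma, this identifies `e` with the tree edge from `w e` to its parent: the
members containing the outer end are exactly those strictly above `w e`. -/
theorem hull_endpoint_false (h : N.LaminarCover H J w) {e : E} (he : e ∈ J) :
    hull (J.image w) {N.endpoint w e false} = parent (J.image w) (w e) := by
  have hmem : N.endpoint w e true ∈ w e := (h.endpoint_mem he true).2 rfl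
  have hnot : N.endpoint w e false ∉ w e := fun hc => by simpa using (h.endpoint_mem he false).1 hc
  unfold hull parent
  congr 1
  refine Finset.filter_congr fun B hB => ?_
  rw [Finset.singleton_subset_iff]
  obtain ⟨f, hf, rfl⟩ := Finset.mem_image.1 hB
  constructor
  · intro hin
    have hfe : f ≠ e := by rintro rfl; exact hnot hin
    have := (h.endpoint_mem_iff he hf hfe).2 hin
    rcases h.laminar.cases (Finset.mem_image_of_mem w he) hB hmem this with hs | hs
    · exact hs.ssubset_of_ne fun hc => hnot (hc ▸ hin)
    · exact absurd (hs hin) hnot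
  · intro hss
    have hfe : f ≠ e := by rintro rfl; exact hss.ne rfl
    exact (h.endpoint_mem_iff he hf hfe).1 (hss.subset hmem)

/-- A core that meets a layer of the tree strictly below a path without special nodes contains the
upper layers of the path. -/
theorem layer_subset_core (h : N.LaminarCover H J w) {S T C : Finset V} (hS : S ∈ J.image w)
    (hT : T ∈ J.image w) (hST : S ⊂ T)
    (hpath : ∀ X ∈ J.image w, S ⊆ X → X ⊆ T → ¬ Special (J.image w) (cores H) X)
    (hC : C ∈ cores H) {u : V} (hu : u ∈ C) (huS : hull (J.image w) {u} = S) {x : V}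
    (hx : hull (J.image w) {x} = T) : x ∈ C := by
  set L := J.image w with hL
  have lam : Laminar L := h.laminar
  have hSne := h.nonempty (h.mem_of_mem_image hS)
  have hCne := h.nonempty (mem_cores.1 hC).1
  have huS' : u ∈ S := by rw [← huS]; exact subset_hull L {u} (by simp)
  have hxT : x ∈ T := by rw [← hx]; exact subset_hull L {x} (by simp)
  obtain ⟨R, hR, hSR, hRT, hRp⟩ := lam.exists_child (Finset.mem_insert_of_mem hT) hS hSne hST
  have hTns := hpath T hT hST.subset subset_rfl
  have hchild : ∀ Z ∈ L, parent L Z = T → Z = R := by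
    intro Z hZ hZp
    by_contra hne
    refine hTns (.inr (.inr ?_))
    exact Finset.one_lt_card.2 ⟨Z, by simp [hZ, hZp], R, by simp [hR, hRp], hne⟩
  have hxR : x ∉ R := fun hc => by
    have := hull_subset hR (Finset.singleton_subset_iff.2 hc)
    rw [hx] at this
    exact hRT.not_subset this
  -- Otherwise the hull of `C` would be a special node on the path. So `C` crosses every node of the
  -- path.
  have hCT : ¬ C ⊆ T := fun hc => by
    refine hpath (hull L C) (lam.hull_mem hCne hT hc) ?_ (hull_subset hT hc)
      (.inr (.inl ⟨C, hC, rfl⟩))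
    rw [← huS]
    exact hull_subset (lam.hull_mem hCne hT hc) (Finset.singleton_subset_iff.2 (subset_hull L C hu))
  have cross : ∀ Z ∈ L, S ⊆ Z → Z ⊆ T → Cross C Z := fun Z hZ hSZ hZT => by
    rcases h.pliable.core_cases h.univ_notMem hC (h.mem_of_mem_image hZ) with hd | hd | hd
    · exact absurd (hSZ huS') (Finset.disjoint_left.1 hd hu)
    · exact absurd (hd.trans hZT) hCT
    · exact hd
  rcases h.gamma R (h.mem_of_mem_image hR) T (h.mem_of_mem_image hT) hRT C hC
    (cross R hR hSR hRT.subset) (cross T hT hST.subset subset_rfl) with h0 | h0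
  · by_contra hxC
    have : x ∈ T \ (R ∪ C) := by simp [hxT, hxR, hxC]
    simp [h0] at this
  -- A core inside `T \ (R ∪ C)` would have hull `T`, making `T` special, or lie below the only
  -- child `R` of `T`, from which it is disjoint.
  · exfalso
    obtain ⟨D, hD, hDsub⟩ := exists_core_subset h0
    have hDne := h.nonempty (mem_cores.1 hD).1
    have hDT : D ⊆ T := hDsub.trans Finset.sdiff_subset
    have hDmem := lam.hull_mem hDne hT hDT
    by_cases hcase : hull L D = T
    · exact hTns (.inr (.inl ⟨D, hD, hcase⟩))
    · obtain ⟨Z, hZ, hDZ, -, hZp⟩ := lam.exists_child (Finset.mem_insert_of_mem hT) hDmem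
        (hDne.mono (subset_hull L D)) ((hull_subset hT hDT).ssubset_of_ne hcase)
      rw [hchild Z hZ hZp] at hDZ
      obtain ⟨d, hd⟩ := hDne
      have h1 := hDZ (subset_hull L D hd)
      have h2 := hDsub hd
      simp [h1] at h2

/-- The hull of a core inside `S` is a special node below `S`; a largest special node below `S`
serves as base. Nodes with a common base are nested. -/
theorem exists_base (h : N.LaminarCover H J w) {S : Finset V} (hS : S ∈ J.image w) :
    ∃ s ∈ J.image w, Special (J.image w) (cores H) s ∧ s ⊆ S ∧
      ∀ X ∈ J.image w, s ⊂ X → X ⊆ S → ¬ Special (J.image w) (cores H) X := by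
  classical
  obtain ⟨C, hC, hCS⟩ := exists_core_subset (h.mem_of_mem_image hS)
  have hCne := h.nonempty (mem_cores.1 hC).1
  obtain ⟨s, hs, hmax⟩ := Finset.exists_max_image
    ((J.image w).filter fun s => Special (J.image w) (cores H) s ∧ s ⊆ S) Finset.card
    ⟨hull (J.image w) C, Finset.mem_filter.2 ⟨h.laminar.hull_mem hCne hS hCS,
      .inr (.inl ⟨C, hC, rfl⟩), hull_subset hS hCS⟩⟩
  simp only [Finset.mem_filter] at hs hmax
  refine ⟨s, hs.1, hs.2.1, hs.2.2, fun X hX hsX hXS hsp => ?_⟩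
  exact absurd (Finset.card_lt_card hsX) (not_lt.2 (hmax X ⟨hX, hsp, hXS⟩))

end Network.LaminarCover

end

section

variable {V E : Type*} [Fintype V] [DecidableEq V] [Fintype E] [DecidableEq E]

namespace Network.LaminarCover

variable {N : Network V E} {H : Finset (Finset V)} {J : Finset E} {w : E → Finset V}

open Classical in
/-- Five types of pairs of an edge and one of its ends. -/
noncomputable def endType (H : Finset (Finset V)) (J : Finset E)
    (w : E → Finset V) : E × Bool → Fin 5
  | (e, true) =>
    if Special (J.image w) (cores H) (w e) then 0
    else if Special (J.image w) (cores H) (parent (J.image w) (w e)) then 2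
    else 4
  | (e, false) =>
    if Special (J.image w) (cores H) (parent (J.image w) (w e)) then 1
    else if Special (J.image w) (cores H) (w e) ∨
      ¬ ∃ C ∈ cores H, ∃ u ∈ C, hull (J.image w) {u} = w e then 3
    else 4

/-- The pair of an edge and one of its ends such that a core contains this end but not the other. -/
def Counted (N : Network V E) (H : Finset (Finset V)) (J : Finset E) (w : E → Finset V)
    (p : E × Bool) : Prop :=
  p.1 ∈ J ∧ ∃ C ∈ cores H, N.endpoint w p.1 p.2 ∈ C ∧ N.endpoint w p.1 (!p.2) ∉ C

theorem endType_eq_four (h : N.LaminarCover H J w) {p : E × Bool} (hp : Counted N H J w p)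
    (h4 : endType H J w p = 4) :
    ¬ Special (J.image w) (cores H) (w p.1) ∧
    ¬ Special (J.image w) (cores H) (parent (J.image w) (w p.1)) ∧
    ∃ C ∈ cores H, ∃ u ∈ C, hull (J.image w) {u} = w p.1 := by
  obtain ⟨e, b⟩ := p
  obtain ⟨he, C, hC, hin, -⟩ := hp
  cases b
  · simp only [endType] at h4
    split_ifs at h4 with h1 h2 <;> first | exact absurd h4 (by decide) | skip
    push Not at h2
    exact ⟨h2.1, h1, h2.2⟩
  · simp only [endType] at h4
    split_ifs at h4 with h1 h2 <;> first | exact absurd h4 (by decide) | skip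
    exact ⟨h1, h2, C, hC, _, hin, h.hull_endpoint_true he⟩

/-- The parent of a node below a nonspecial node lies in the family. -/
theorem parent_mem (h : N.LaminarCover H J w) {S : Finset V} (hS : S ∈ J.image w)
    (hns : ¬ Special (J.image w) (cores H) (parent (J.image w) S)) :
    parent (J.image w) S ∈ J.image w ∧ S ⊂ parent (J.image w) S := by
  have hSne := h.nonempty (h.mem_of_mem_image hS)
  have hp := h.laminar.parent_mem_insert hSne
  rcases Finset.mem_insert.1 hp with hp | hp
  · exact absurd (.inl hp) hns
  · by_cases hB : ∃ B ∈ J.image w, S ⊂ B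
    · obtain ⟨B, hB, hSB⟩ := hB
      exact h.laminar.parent_mem hSne hB hSB
    · push Not at hB
      refine absurd (.inl ?_) hns
      simp [parent, Finset.filter_eq_empty_iff.2 hB]

theorem subset_parent_cases (h : N.LaminarCover H J w) {S X : Finset V} (hS : S ∈ J.image w)
    (hX : X ∈ J.image w) (hXp : X ⊆ parent (J.image w) S) {v : V} (hvX : v ∈ X) (hvS : v ∈ S) :
    X ⊆ S ∨ X = parent (J.image w) S := by
  rcases h.laminar.cases hX hS hvX hvS with hc | hc
  · exact .inl hc
  · by_cases hSX : S = X
    · exact .inl (hSX ▸ subset_rfl)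
    · exact .inr (hXp.antisymm (parent_subset hX (hc.ssubset_of_ne hSX)))

/-- When `w e` and its parent are both nonspecial, a core containing the inner end contains the
whole layer of the parent, hence the outer end too. -/
theorem endType_true_ne_four (h : N.LaminarCover H J w) {e : E}
    (h1 : Counted N H J w (e, true)) : endType H J w (e, true) ≠ 4 := by
  intro h3
  obtain ⟨hS, hp, -⟩ := h.endType_eq_four h1 h3
  obtain ⟨he, C, hC, hin, hout⟩ := h1
  have hSL := Finset.mem_image_of_mem w he
  obtain ⟨hpL, hSp⟩ := h.parent_mem hSL hp
  refine hout (h.layer_subset_core hSL hpL hSp (fun X hX hSX hXp => ?_) hC hin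
    (h.hull_endpoint_true he) (h.hull_endpoint_false he))
  obtain ⟨v, hv⟩ := h.nonempty (h.mem_of_mem_image hSL)
  rcases h.subset_parent_cases hSL hX hXp (hSX hv) hv with hc | rfl
  · rwa [hc.antisymm hSX]
  · exact hp

/-- On one path above a base, the upper node and the parent of the lower one are nonspecial. Types
0, 1 and 2 each single out an end of the path; types 3 and 4 occur at most once because cores
swallow higher layers. -/
theorem endType_ne_of_ssubset (h : N.LaminarCover H J w) {p q : E × Bool}
    (hp : Counted N H J w p) (hq : Counted N H J w q) (hpq : w p.1 ⊂ w q.1) {s : Finset V}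
    (hs : s ⊆ w p.1)
    (hpath : ∀ X ∈ J.image w, s ⊂ X → X ⊆ w q.1 → ¬ Special (J.image w) (cores H) X) :
    endType H J w p ≠ endType H J w q := by
  intro heq
  have hpJ := hp.1
  have hqJ := hq.1
  have hSL := Finset.mem_image_of_mem w hpJ
  have hTL := Finset.mem_image_of_mem w hqJ
  obtain ⟨v, hv⟩ := h.nonempty (h.mem_of_mem_image hSL)
  have hTns := hpath _ hTL (hs.trans_ssubset hpq) subset_rfl
  obtain ⟨hRL, hSR⟩ := h.laminar.parent_mem ⟨v, hv⟩ hTL hpq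
  have hRT := parent_subset hTL hpq
  have hRns := hpath _ hRL (hs.trans_ssubset hSR) hRT
  -- Type 4 at the lower node provides a core meeting its layer. That core contains both ends of the
  -- upper edge, and disjointness of cores then prevents the upper pair from being counted.
  by_cases h4 : endType H J w p = 4
  · obtain ⟨hSns, -, C, hC, u, huC, hu⟩ := h.endType_eq_four hp h4
    obtain ⟨-, hTp, -⟩ := h.endType_eq_four hq (heq ▸ h4)
    obtain ⟨hPL, hTP⟩ := h.parent_mem hTL hTp
    have hpath' : ∀ X ∈ J.image w, w p.1 ⊆ X → X ⊆ w q.1 →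
        ¬ Special (J.image w) (cores H) X := by
      intro X hX h1 h2
      by_cases hXS : X = w p.1
      · rwa [hXS]
      · exact hpath X hX (hs.trans_ssubset (h1.ssubset_of_ne (Ne.symm hXS))) h2
    have in1 : N.endpoint w q.1 true ∈ C :=
      h.layer_subset_core hSL hTL hpq hpath' hC huC hu (h.hull_endpoint_true hqJ)
    have in2 : N.endpoint w q.1 false ∈ C := by
      refine h.layer_subset_core hSL hPL (hpq.trans hTP) (fun X hX h1 h2 => ?_) hC huC hu
        (h.hull_endpoint_false hqJ)
      rcases h.subset_parent_cases hTL hX h2 (h1 hv) (hpq.subset hv) with hc | rfl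
      · exact hpath' X hX h1 hc
      · exact hTp
    obtain ⟨-, D, hD, hin, hout⟩ := hq
    by_cases hCD : C = D
    · subst hCD
      cases hb : q.2 <;> simp [hb] at hin hout <;> contradiction
    · have := Finset.disjoint_left.1 (h.pliable.disjoint_cores hC hD hCD)
      cases hb : q.2 <;> simp [hb] at hin
      · exact this in2 hin
      · exact this in1 hin
  · obtain ⟨e, b⟩ := p
    obtain ⟨f, c⟩ := q
    cases b
    · cases c
      · simp only [endType, hRns, hTns, if_false, false_or] at heq h4
        split_ifs at heq h4 <;> first | exact absurd heq (by decide) | exact h4 rfl | skip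
        -- Type 3 at the nonspecial upper node says that no core meets its layer. But the core
        -- counted at the lower edge meets the layer of the parent, and so the layer of every higher
        -- node of the path.
        have h2 : ¬ ∃ C ∈ cores H, ∃ u ∈ C, hull (J.image w) {u} = w f := by assumption
        obtain ⟨-, C, hC, hin, -⟩ := hp
        simp only at hin hRL hSR hRT hRns hTL hpJ hqJ hpq
        by_cases hRT' : parent (J.image w) (w e) = w f
        · exact h2 ⟨C, hC, _, hin, by rw [← hRT']; exact h.hull_endpoint_false hpJ⟩
        · refine h2 ⟨C, hC, _, h.layer_subset_core hRL hTL (hRT.ssubset_of_ne hRT')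
            (fun X hX h5 h6 => hpath X hX ?_ h6) hC hin (h.hull_endpoint_false hpJ)
            (h.hull_endpoint_true hqJ), h.hull_endpoint_true hqJ⟩
          exact hs.trans_ssubset (hSR.trans_subset h5)
      · simp only [endType, hRns, hTns, if_false] at heq h4
        split_ifs at heq h4 <;> first | exact absurd heq (by decide) | exact h4 rfl
    · cases c
      · simp only [endType, hRns, hTns, if_false] at heq h4
        split_ifs at heq h4 <;> first | exact absurd heq (by decide) | exact h4 rfl
      · simp only [endType, hRns, hTns, if_false] at heq h4
        split_ifs at heq h4 <;> first | exact absurd heq (by decide) | exact h4 rfl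

open Classical in
-- Each pair is charged to its type together with the base of its tree edge; five types give the
-- factor five.
theorem card_counted_le (h : N.LaminarCover H J w) :
    ((J ×ˢ Finset.univ).filter (Counted N H J w)).card ≤
      5 * ((J.image w).filter (Special (J.image w) (cores H))).card := by
  choose! base hbL hbS hbsub hbpath using fun S (hS : S ∈ J.image w) => h.exists_base hS
  have hcard : ((Finset.univ : Finset (Fin 5)) ×ˢ
      ((J.image w).filter (Special (J.image w) (cores H)))).card =
      5 * ((J.image w).filter (Special (J.image w) (cores H))).card := by
    simp [Finset.card_product]
  rw [← hcard]
  refine Finset.card_le_card_of_injOn (fun p => (endType H J w p, base (w p.1))) ?_ ?_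
  · intro p hp
    have hpJ : p.1 ∈ J := (Finset.mem_filter.1 hp).2.1
    have hSL := Finset.mem_image_of_mem w hpJ
    simpa using ⟨by simpa using hbL _ hSL, hbS _ hSL⟩
  · intro p hp q hq hpq
    have hp := (Finset.mem_filter.1 hp).2
    have hq := (Finset.mem_filter.1 hq).2
    simp only [Prod.mk.injEq] at hpq
    obtain ⟨htype, hbase⟩ := hpq
    have hSL := Finset.mem_image_of_mem w hp.1
    have hTL := Finset.mem_image_of_mem w hq.1
    obtain ⟨v, hv⟩ := h.nonempty (h.mem_of_mem_image (hbL _ hSL))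
    have hST := h.laminar.cases hSL hTL (hbsub _ hSL hv) (hbsub _ hTL (hbase ▸ hv))
    have hw : w p.1 = w q.1 := by
      by_contra hne
      rcases hST with hs | hs
      · exact h.endType_ne_of_ssubset hp hq (hs.ssubset_of_ne hne) (hbsub _ hSL)
          (hbase ▸ hbpath _ hTL) htype
      · exact h.endType_ne_of_ssubset hq hp (hs.ssubset_of_ne (Ne.symm hne)) (hbsub _ hTL)
          (hbase ▸ hbpath _ hSL) htype.symm
    have he := h.injOn hp.1 hq.1 hw
    obtain ⟨e, b⟩ := p
    obtain ⟨f, c⟩ := q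
    simp only at he
    subst he
    -- The two ends of one edge can share only type 4, which an inner end never has when counted.
    have key : ∀ {x : E}, Counted N H J w (x, true) →
        endType H J w (x, true) = endType H J w (x, false) → False := by
      intro x h1 h3
      by_cases h4 : endType H J w (x, true) = 4
      · exact h.endType_true_ne_four h1 h4
      · simp only [endType] at h3 h4
        split_ifs at h3 h4 <;> first | exact absurd h3 (by decide) | exact h4 rfl
    cases b <;> cases c
    · rfl
    · exact (key hq htype.symm).elim
    · exact (key hp htype).elim
    · rfl

/-- An edge leaving a core is recorded by its end inside the core. Since cores are disjoint, that
end determines the core. -/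
theorem sum_cut_le_card_counted (h : N.LaminarCover H J w) [DecidablePred (Counted N H J w)] :
    ∑ C ∈ cores H, (N.cut J C).card ≤ ((J ×ˢ Finset.univ).filter (Counted N H J w)).card := by
  classical
  rw [← Finset.card_sigma]
  refine Finset.card_le_card_of_injOn
    (fun x => (x.2, decide (N.endpoint w x.2 true ∈ x.1))) ?_ ?_
  · rintro ⟨C, e⟩ hx
    simp only [Finset.coe_sigma, Set.mem_sigma_iff, Finset.mem_coe, Network.cut,
      Finset.mem_filter, covers_iff_endpoint (w := w)] at hx
    obtain ⟨hC, he, hcov⟩ := hx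
    simp only [Finset.coe_filter, Finset.mem_product, Finset.mem_univ, and_true, Set.mem_ofPred_eq]
    refine ⟨he, he, C, hC, ?_⟩
    by_cases h1 : N.endpoint w e true ∈ C
    · simpa [h1] using hcov
    · simpa [h1] using hcov
  · rintro ⟨C, e⟩ hx ⟨D, f⟩ hy hxy
    simp only [Finset.coe_sigma, Set.mem_sigma_iff, Finset.mem_coe, Network.cut,
      Finset.mem_filter, covers_iff_endpoint (w := w)] at hx hy
    simp only [Prod.mk.injEq, decide_eq_decide] at hxy
    obtain ⟨rfl, hiff⟩ := hxy
    have : C = D := by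
      by_contra hne
      have hdis := Finset.disjoint_left.1 (h.pliable.disjoint_cores hx.1 hy.1 hne)
      by_cases h1 : N.endpoint w e true ∈ C
      · exact hdis h1 (hiff.1 h1)
      · have h2 : N.endpoint w e true ∉ D := fun h2 => h1 (hiff.2 h2)
        exact hdis (by simpa [h1] using hx.2.2) (by simpa [h2] using hy.2.2)
    rw [this]

end Network.LaminarCover

/-- The degrees of the cores in a minimal cover are at most ten on average. -/
theorem Network.sum_cut_cores_le {N : Network V E} {H : Finset (Finset V)} {J : Finset E}
    (hH : Pliable H)
    (hγ : ∀ S₁ ∈ H, ∀ S₂ ∈ H, S₁ ⊂ S₂ → ∀ C ∈ cores H, Cross C S₁ → Cross C S₂ →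
      S₂ \ (S₁ ∪ C) = ∅ ∨ S₂ \ (S₁ ∪ C) ∈ H)
    (hJ : ∀ S ∈ H, ∃ g ∈ J, N.Covers g S) (hmin : ∀ e ∈ J, ∃ S, N.IsWitness H J e S) :
    ∑ C ∈ cores H, (N.cut J C).card ≤ 10 * (cores H).card := by
  classical
  obtain ⟨w, hw, hlam⟩ := exists_laminar_witnesses hH hJ hmin
  have h : N.LaminarCover H J w := ⟨hH, hγ, hJ, hw, fun A hA B hB => by
    obtain ⟨e, he, rfl⟩ := Finset.mem_image.1 hA
    obtain ⟨f, hf, rfl⟩ := Finset.mem_image.1 hB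
    exact hlam e he f hf⟩
  -- The strict bound on special nodes needs a nonempty tree.
  rcases J.eq_empty_or_nonempty with rfl | hne
  · simp [Network.cut]
  have h1 := h.sum_cut_le_card_counted
  have h2 := h.card_counted_le
  have h3 := h.laminar.card_special_lt (Cs := cores H) (hne.image w)
    (fun X hX => h.nonempty (h.mem_of_mem_image hX))
    (fun hu => h.univ_notMem (h.mem_of_mem_image hu))
    (fun X hX => by
      obtain ⟨C, hC, hCX⟩ := exists_core_subset (h.mem_of_mem_image hX)
      exact ⟨C, hC, h.nonempty (mem_cores.1 hC).1, hCX⟩)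
  omega

end

section

variable {V E : Type*} [Fintype V] [DecidableEq V] [Fintype E] [DecidableEq E]

/-! ### Residual families -/

theorem Network.mem_cut {N : Network V E} {J : Finset E} {S : Finset V} {e : E} :
    e ∈ N.cut J S ↔ e ∈ J ∧ N.Covers e S := by
  simp [Network.cut]

theorem Network.mem_residual {N : Network V E} {F : Finset (Finset V)} {I : Finset E}
    {S : Finset V} : S ∈ N.residual F I ↔ S ∈ F ∧ ∀ e ∈ I, ¬ N.Covers e S := by
  simp only [Network.residual, Finset.mem_filter, Finset.card_eq_zero,
    Finset.eq_empty_iff_forall_notMem, mem_cut, not_and]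

theorem Network.coversFamily_iff {N : Network V E} {F : Finset (Finset V)} {J : Finset E} :
    N.CoversFamily F J ↔ ∀ S ∈ F, ∃ e ∈ J, N.Covers e S := by
  simp only [Network.CoversFamily, Finset.one_le_card, Finset.Nonempty, mem_cut]

theorem Network.CoversFamily.mono {N : Network V E} {F : Finset (Finset V)} {J K : Finset E}
    (h : N.CoversFamily F J) (hJK : J ⊆ K) : N.CoversFamily F K := by
  rw [coversFamily_iff] at h ⊢
  intro S hS
  obtain ⟨e, he, heS⟩ := h S hS
  exact ⟨e, hJK he, heS⟩

theorem Network.cores_residual_eq_empty_iff {N : Network V E} {F : Finset (Finset V)}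
    {J : Finset E} : cores (N.residual F J) = ∅ ↔ N.CoversFamily F J := by
  rw [coversFamily_iff]
  constructor
  · intro h S hS
    by_contra hc
    obtain ⟨C, hC, -⟩ := exists_core_subset
      (mem_residual.2 ⟨hS, fun e he heS => hc ⟨e, he, heS⟩⟩)
    simp [h] at hC
  · intro h
    rw [Finset.eq_empty_iff_forall_notMem]
    intro C hC
    obtain ⟨hCF, hno⟩ := mem_residual.1 (mem_cores.1 hC).1
    obtain ⟨e, he, heC⟩ := h C hCF
    exact hno e he heC

theorem Network.mem_of_mem_cores_residual {N : Network V E} {F : Finset (Finset V)}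
    {I : Finset E} {C : Finset V} (hC : C ∈ cores (N.residual F I)) :
    C ∈ F ∧ ∀ e ∈ I, ¬ N.Covers e C :=
  mem_residual.1 (mem_cores.1 hC).1

/-- An edge covering neither `A` nor `B` covers none of their corners, so the residual family
contains the same corners as `F`. -/
theorem Pliable.residual {N : Network V E} {F : Finset (Finset V)} (hF : Pliable F)
    (I : Finset E) : Pliable (N.residual F I) := by
  intro A hA B hB
  rw [Network.mem_residual] at hA hB
  have h := hF A hA.1 B hB.1
  have hcongr : ([A ∩ B, A ∪ B, A \ B, B \ A].filter (fun X => X ∈ N.residual F I)) =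
      ([A ∩ B, A ∪ B, A \ B, B \ A].filter (fun X => X ∈ F)) := by
    refine List.filter_congr fun X hX => ?_
    rw [decide_eq_decide, Network.mem_residual]
    refine ⟨fun h => h.1, fun h => ⟨h, fun e he => ?_⟩⟩
    have h1 := not_not.1 (hA.2 e he)
    have h2 := not_not.1 (hB.2 e he)
    simp only [List.mem_cons, List.not_mem_nil, or_false] at hX
    rcases hX with rfl | rfl | rfl | rfl <;> simp [Network.Covers, h1, h2]
  rwa [hcongr]

/-! ### The dual solution -/

theorem Network.load_raise {N : Network V E} {F Cs : Finset (Finset V)} (hCs : Cs ⊆ F)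
    (y : Finset V → ℝ) (ε : ℝ) (e : E) :
    N.load F (raise y Cs ε) e =
      N.load F y e + (Cs.filter fun C => N.Covers e C).card * ε := by
  unfold Network.load raise
  rw [Finset.sum_add_distrib, Finset.sum_ite_mem, Finset.sum_const, nsmul_eq_mul]
  congr 4
  ext C
  simp only [Finset.mem_inter, Finset.mem_filter]
  exact ⟨fun h => ⟨h.2, h.1.2⟩, fun h => ⟨⟨hCs h.1, h.2⟩, h.1⟩⟩

/-- Loads of selected edges are frozen, since these edges cover no residual core. Hence tight edges
stay tight and feasible. -/
theorem Network.load_raise_of_mem {N : Network V E} {F : Finset (Finset V)} {I : Finset E}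
    (y : Finset V → ℝ) (ε : ℝ) {e : E} (he : e ∈ I) :
    N.load F (raise y (cores (N.residual F I)) ε) e = N.load F y e := by
  rw [load_raise fun C hC => (mem_of_mem_cores_residual hC).1, Finset.filter_eq_empty_iff.2]
  · simp
  · exact fun C hC => (mem_of_mem_cores_residual hC).2 e he

theorem Phase1.nodup {N : Network V E} {F : Finset (Finset V)} {l : List E}
    {y : Finset V → ℝ} (h : Phase1 N F l y) : l.Nodup := by
  induction h with
  | start => exact List.nodup_nil
  | step l y e ε _ _ hnew _ _ _ _ ih => exact List.nodup_cons.2 ⟨hnew, ih⟩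

theorem Phase1.nonneg {N : Network V E} {F : Finset (Finset V)} {l : List E}
    {y : Finset V → ℝ} (h : Phase1 N F l y) (S : Finset V) : 0 ≤ y S := by
  induction h with
  | start => exact le_rfl
  | step l y e ε _ _ _ hε _ _ _ ih =>
    unfold raise
    split_ifs
    · exact add_nonneg ih hε
    · simpa using ih

theorem Phase1.tight_of_mem {N : Network V E} {F : Finset (Finset V)} {l : List E}
    {y : Finset V → ℝ} (h : Phase1 N F l y) : ∀ e ∈ l, N.load F y e = N.cost e := by
  induction h with
  | start => simp
  | step l y e ε _ _ _ _ _ htight _ ih =>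
    intro f hf
    by_cases hfl : f ∈ l
    · rw [Network.load_raise_of_mem _ _ (List.mem_toFinset.2 hfl), ih f hfl]
    · obtain rfl : f = e := (List.mem_cons.1 hf).resolve_right hfl
      exact htight

theorem Phase1.load_le {N : Network V E} {F : Finset (Finset V)} {l : List E}
    {y : Finset V → ℝ} (h : Phase1 N F l y) (e : E) : N.load F y e ≤ N.cost e := by
  induction h with
  | start => simpa [Network.load] using N.cost_nonneg e
  | step l y e' ε _ _ _ _ hno _ _ ih =>
    by_cases hfl : e ∈ l
    · rwa [Network.load_raise_of_mem _ _ (List.mem_toFinset.2 hfl)]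
    · exact hno e hfl

theorem Network.sum_load (N : Network V E) (F : Finset (Finset V)) (y : Finset V → ℝ)
    (J : Finset E) : ∑ e ∈ J, N.load F y e = ∑ S ∈ F, y S * (N.cut J S).card := by
  simp only [Network.load, Finset.sum_filter]
  rw [Finset.sum_comm]
  refine Finset.sum_congr rfl fun S _ => ?_
  rw [← Finset.sum_filter, Finset.sum_const, nsmul_eq_mul, mul_comm]
  rfl

theorem Network.DualFeasible.dualValue_le {N : Network V E} {F : Finset (Finset V)}
    {y : Finset V → ℝ} (hy : N.DualFeasible F y) {J : Finset E} (hJ : N.CoversFamily F J) :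
    dualValue F y ≤ N.totalCost J := by
  calc dualValue F y ≤ ∑ S ∈ F, y S * (N.cut J S).card := by
        refine Finset.sum_le_sum fun S hS => le_mul_of_one_le_right (hy.1 S hS) ?_
        exact_mod_cast hJ S hS
    _ = ∑ e ∈ J, N.load F y e := (N.sum_load F y J).symm
    _ ≤ N.totalCost J := Finset.sum_le_sum fun e _ => hy.2 e

/-! ### Reverse delete -/

/-- One step of the second phase. -/
def Network.deleteStep (N : Network V E) (F : Finset (Finset V)) (I : Finset E) (e : E) :
    Finset E :=
  if N.CoversFamily F (I.erase e) then I.erase e else I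

theorem Network.deleteStep_subset {N : Network V E} {F : Finset (Finset V)} (I : Finset E)
    (e : E) : N.deleteStep F I e ⊆ I := by
  unfold deleteStep
  split_ifs
  · exact Finset.erase_subset _ _
  · exact subset_rfl

theorem Network.CoversFamily.deleteStep {N : Network V E} {F : Finset (Finset V)}
    {I : Finset E} (h : N.CoversFamily F I) (e : E) :
    N.CoversFamily F (N.deleteStep F I e) := by
  unfold Network.deleteStep
  split_ifs with h'
  · exact h'
  · exact h

theorem Network.foldl_deleteStep_subset {N : Network V E} {F : Finset (Finset V)} (l : List E)
    (I : Finset E) : l.foldl (N.deleteStep F) I ⊆ I := by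
  induction l generalizing I with
  | nil => exact subset_rfl
  | cons e l ih => exact (ih _).trans (deleteStep_subset I e)

theorem Network.CoversFamily.foldl_deleteStep {N : Network V E} {F : Finset (Finset V)}
    (l : List E) {I : Finset E} (h : N.CoversFamily F I) :
    N.CoversFamily F (l.foldl (N.deleteStep F) I) := by
  induction l generalizing I with
  | nil => exact h
  | cons e l ih => exact ih (h.deleteStep e)

/-- When `e` is examined, the current set still contains all of `l'`, whose edges come later in the
deletion order, as well as everything that survives. Keeping `e` means this larger set without `e`
was no cover. -/
theorem Network.not_coversFamily_of_mem_foldl {N : Network V E} {F : Finset (Finset V)}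
    {l : List E} (hl : l.Nodup) {I : Finset E} (hlI : ∀ e ∈ l, e ∈ I) {l' : List E}
    (hl' : l' <:+ l) {e : E} (hel : e ∈ l) (he : e ∈ l.foldl (N.deleteStep F) I) (hel' : e ∉ l') :
    ¬ N.CoversFamily F ((l.foldl (N.deleteStep F) I ∪ l'.toFinset).erase e) := by
  induction l generalizing I with
  | nil => simp at hel
  | cons x l ih =>
    rw [List.nodup_cons] at hl
    rw [List.foldl_cons] at he ⊢
    have hlx : ∀ f ∈ l, f ∈ N.deleteStep F I x := by
      intro f hf
      have hfI := hlI f (List.mem_cons_of_mem _ hf)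
      unfold deleteStep
      split_ifs
      · exact Finset.mem_erase.2 ⟨fun h => hl.1 (h ▸ hf), hfI⟩
      · exact hfI
    rcases List.suffix_cons_iff.1 hl' with rfl | hl''
    · exact absurd hel hel'
    rcases List.mem_cons.1 hel with rfl | hel
    · have he' := foldl_deleteStep_subset _ _ he
      have hnot : ¬ N.CoversFamily F (I.erase e) := fun h => by
        rw [deleteStep, if_pos h] at he'
        exact Finset.notMem_erase _ _ he'
      refine fun h => hnot (h.mono (Finset.erase_subset_erase _ ?_))
      refine Finset.union_subset ((foldl_deleteStep_subset _ _).trans (deleteStep_subset _ _)) ?_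
      intro f hf
      exact hlI f (hl'.subset (List.mem_toFinset.1 hf))
    · exact ih hl.2 hlx hl'' hel he

theorem Network.reverseDelete_eq (N : Network V E) (F : Finset (Finset V)) (l : List E) :
    N.reverseDelete F l = l.foldl (N.deleteStep F) l.toFinset := rfl

/-- A set left uncovered by `J ∪ l'` minus `e` is residual for `l'`, and `e` is the only edge of `J`
that can cover it. -/
theorem Network.exists_witness_of_mem_reverseDelete {N : Network V E} {F : Finset (Finset V)}
    {l l' : List E} (hl : l.Nodup) (hcov : N.CoversFamily F l.toFinset) (hl' : l' <:+ l) {e : E}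
    (he : e ∈ N.reverseDelete F l) (hel' : e ∉ l') :
    ∃ S ∈ N.residual F l'.toFinset, ∀ g ∈ N.reverseDelete F l, N.Covers g S ↔ g = e := by
  rw [reverseDelete_eq] at he ⊢
  have hel : e ∈ l := List.mem_toFinset.1 (foldl_deleteStep_subset _ _ he)
  have hnot := not_coversFamily_of_mem_foldl hl (fun e he => List.mem_toFinset.2 he) hl' hel he hel'
  rw [coversFamily_iff] at hnot
  push Not at hnot
  obtain ⟨S, hS, hno⟩ := hnot
  have hJ := coversFamily_iff.1 (hcov.foldl_deleteStep (N := N) l) S hS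
  have hno' : ∀ g ∈ l.foldl (N.deleteStep F) l.toFinset ∪ l'.toFinset, N.Covers g S → g = e :=
    fun g hg hgS => by
      by_contra hne
      exact hgS (hno g (Finset.mem_erase.2 ⟨hne, hg⟩))
  refine ⟨S, mem_residual.2 ⟨hS, fun g hg hgS => ?_⟩, fun g hg => ⟨?_, ?_⟩⟩
  · have := hno' g (Finset.mem_union_right _ hg) hgS
    exact hel' (this ▸ List.mem_toFinset.1 hg)
  · exact hno' g (Finset.mem_union_left _ hg)
  · rintro rfl
    obtain ⟨f, hf, hfS⟩ := hJ
    rwa [← hno' f (Finset.mem_union_left _ hf) hfS]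

/-! ### The approximation ratio -/

/-- The final `J` is fixed while the induction runs over iterations. Quantifying minimality over all
suffixes makes it available at each one. -/
theorem Phase1.sum_cut_le {N : Network V E} {F : Finset (Finset V)} (hF : N.GammaPliable F)
    {J : Finset E} (hJ : N.CoversFamily F J) {l : List E} {y : Finset V → ℝ}
    (h : Phase1 N F l y)
    (hmin : ∀ l', l' <:+ l → ∀ e ∈ J, e ∉ l' →
      ∃ S ∈ N.residual F l'.toFinset, ∀ g ∈ J, N.Covers g S ↔ g = e) :
    ∑ S ∈ F, y S * (N.cut J S).card ≤ 10 * ∑ S ∈ F, y S := by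
  induction h with
  | start => simp
  | step l y e ε _ _ _ hε _ _ _ ih =>
    have ih := ih fun l' hl' => hmin l' (hl'.trans (List.suffix_cons _ _))
    set Cs := cores (N.residual F l.toFinset) with hCs
    have hCsF : Cs ⊆ F := fun C hC => (Network.mem_of_mem_cores_residual hC).1
    -- Selected edges cover no residual set, so the degree bound may be applied to the edges of `J`
    -- outside `l`.
    have hcut : ∀ S ∈ N.residual F l.toFinset,
        N.cut (J.filter (· ∉ l)) S = N.cut J S := by
      intro S hS
      ext g
      simp only [Network.mem_cut, Finset.mem_filter]
      refine ⟨fun hg => ⟨hg.1.1, hg.2⟩, fun hg => ⟨⟨hg.1, fun hgl => ?_⟩, hg.2⟩⟩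
      exact (Network.mem_residual.1 hS).2 g (List.mem_toFinset.2 hgl) hg.2
    have hdeg : ∑ C ∈ Cs, (N.cut J C).card ≤ 10 * Cs.card := by
      have := Network.sum_cut_cores_le (N := N) (H := N.residual F l.toFinset)
        (J := J.filter (· ∉ l)) (hF.1.residual _) (hF.2 l.toFinset) ?_ ?_
      · rw [← hCs] at this
        rwa [Finset.sum_congr rfl fun C hC => by rw [hcut C (mem_cores.1 hC).1]] at this
      · intro S hS
        obtain ⟨hSF, hSl⟩ := Network.mem_residual.1 hS
        obtain ⟨g, hg, hgS⟩ := Network.coversFamily_iff.1 hJ S hSF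
        exact ⟨g, Finset.mem_filter.2
          ⟨hg, fun hgl => hSl g (List.mem_toFinset.2 hgl) hgS⟩, hgS⟩
      · intro f hf
        obtain ⟨hfJ, hfl⟩ := Finset.mem_filter.1 hf
        obtain ⟨S, hS, hw⟩ := hmin l (List.suffix_cons _ _) f hfJ hfl
        exact ⟨S, hS, fun g hg => hw g (Finset.mem_filter.1 hg).1⟩
    have hdeg' : ∑ C ∈ Cs, ((N.cut J C).card : ℝ) ≤ 10 * Cs.card := by exact_mod_cast hdeg
    have e1 : ∑ S ∈ F, raise y Cs ε S * ((N.cut J S).card : ℝ) =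
        ∑ S ∈ F, y S * ((N.cut J S).card : ℝ) + ε * ∑ C ∈ Cs, ((N.cut J C).card : ℝ) := by
      simp only [raise, add_mul, Finset.sum_add_distrib, ite_mul, zero_mul]
      rw [Finset.sum_ite_mem, Finset.inter_eq_right.2 hCsF, Finset.mul_sum]
    have e2 : ∑ S ∈ F, raise y Cs ε S = ∑ S ∈ F, y S + ε * Cs.card := by
      simp only [raise, Finset.sum_add_distrib]
      rw [Finset.sum_ite_mem, Finset.inter_eq_right.2 hCsF, Finset.sum_const, nsmul_eq_mul,
        mul_comm]
    rw [e1, e2]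
    nlinarith [mul_le_mul_of_nonneg_left hdeg' hε]

theorem Network.AlgorithmResult.approximation {N : Network V E} {F : Finset (Finset V)}
    (hF : N.GammaPliable F) {J : Finset E} {y : Finset V → ℝ} (h : N.AlgorithmResult F J y) :
    N.CoversFamily F J ∧ N.DualFeasible F y ∧ N.totalCost J ≤ 10 * dualValue F y ∧
      ∀ J' : Finset E, N.CoversFamily F J' → N.totalCost J ≤ 10 * N.totalCost J' := by
  obtain ⟨l, hrun, hcores, rfl⟩ := h
  have hcov := cores_residual_eq_empty_iff.1 hcores
  have hJ : N.CoversFamily F (N.reverseDelete F l) := hcov.foldl_deleteStep l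
  have hy : N.DualFeasible F y := ⟨fun S _ => hrun.nonneg S, hrun.load_le⟩
  have hcost : N.totalCost (N.reverseDelete F l) ≤ 10 * dualValue F y := by
    have e1 : N.totalCost (N.reverseDelete F l) =
        ∑ e ∈ N.reverseDelete F l, N.load F y e :=
      Finset.sum_congr rfl fun e he =>
        (hrun.tight_of_mem e (List.mem_toFinset.1 (foldl_deleteStep_subset _ _ he))).symm
    rw [e1, sum_load]
    exact hrun.sum_cut_le hF hJ fun l' hl' e he hel' =>
      exists_witness_of_mem_reverseDelete hrun.nodup hcov hl' he hel'
  refine ⟨hJ, hy, hcost, fun J' hJ' => hcost.trans ?_⟩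
  have := hy.dualValue_le hJ'
  linarith

end

/-! ### Reasoning about programs -/

section

variable {n m : ℕ} {oracle : Finset (Fin m) → List (Finset (Fin n))}

/-- Started with memory `s`, the program `P` halts after at most `T` steps with a memory that
satisfies `Q`. -/
def Ensures (oracle : Finset (Fin m) → List (Finset (Fin n))) (P : Program) (T : ℕ) (s : Store)
    (Q : Store → Prop) : Prop :=
  ∃ s' t, Runs oracle P s s' t ∧ t ≤ T ∧ Q s'

namespace Ensures

theorem mono {P : Program} {T T' : ℕ} {s : Store} {Q Q' : Store → Prop}
    (h : Ensures oracle P T s Q) (hT : T ≤ T') (hQ : ∀ s', Q s' → Q' s') :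
    Ensures oracle P T' s Q' := by
  obtain ⟨s', t, hr, ht, hq⟩ := h
  exact ⟨s', t, hr, ht.trans hT, hQ s' hq⟩

theorem skip {s : Store} {Q : Store → Prop} (h : Q s) : Ensures oracle .skip 1 s Q :=
  ⟨s, 1, .skip s, le_rfl, h⟩

theorem setNat {a : NatArray} {i j x : NatExpr} {s : Store} {Q : Store → Prop}
    (h : Q (s.setNat a (i.eval s) (j.eval s) (x.eval s))) :
    Ensures oracle (.setNat a i j x) 1 s Q :=
  ⟨_, 1, .setNat s a i j x, le_rfl, h⟩

theorem setReal {a : RealArray} {i j : NatExpr} {x : RealExpr} {s : Store} {Q : Store → Prop}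
    (h : Q (s.setReal a (i.eval s) (j.eval s) (x.eval s))) :
    Ensures oracle (.setReal a i j x) 1 s Q :=
  ⟨_, 1, .setReal s a i j x, le_rfl, h⟩

theorem seq {P P' : Program} {T T' : ℕ} {s : Store} {R Q : Store → Prop}
    (h : Ensures oracle P T s R) (h' : ∀ s', R s' → Ensures oracle P' T' s' Q) :
    Ensures oracle (.seq P P') (T + T') s Q := by
  obtain ⟨s', t, hr, ht, hR⟩ := h
  obtain ⟨s'', t', hr', ht', hQ⟩ := h' s' hR
  exact ⟨s'', t + t', .seq _ _ _ _ _ _ _ hr hr', add_le_add ht ht', hQ⟩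

theorem ite {b : Test} {P P' : Program} {T : ℕ} {s : Store} {Q : Store → Prop}
    (h : b.holds s → Ensures oracle P T s Q) (h' : ¬ b.holds s → Ensures oracle P' T s Q) :
    Ensures oracle (.ite b P P') (T + 1) s Q := by
  by_cases hb : b.holds s
  · obtain ⟨s', t, hr, ht, hq⟩ := h hb
    exact ⟨s', t + 1, .iteTrue _ _ _ _ _ _ hb hr, Nat.succ_le_succ ht, hq⟩
  · obtain ⟨s', t, hr, ht, hq⟩ := h' hb
    exact ⟨s', t + 1, .iteFalse _ _ _ _ _ _ hb hr, Nat.succ_le_succ ht, hq⟩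

/-- The index `k` bounds the remaining passes: a pass is possible only if `k` is positive, and
lowers it by one. -/
theorem loop {b : Test} {P : Program} {T : ℕ} {Inv : ℕ → Store → Prop}
    (body : ∀ k s, Inv k s → b.holds s →
      ∃ k', k = k' + 1 ∧ Ensures oracle P T s (Inv k'))
    (k : ℕ) {s : Store} (h : Inv k s) :
    Ensures oracle (.loop b P) (k * (T + 1) + 1) s (fun s' => ¬ b.holds s' ∧ ∃ k', Inv k' s') := by
  induction k generalizing s with
  | zero =>
    have hb : ¬ b.holds s := fun hb => by
      obtain ⟨k', hk, -⟩ := body _ _ h hb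
      omega
    exact ⟨s, 1, .loopDone _ _ _ hb, by omega, hb, _, h⟩
  | succ k ih =>
    by_cases hb : b.holds s
    · obtain ⟨k', hk, s', t, hr, ht, hI⟩ := body _ _ h hb
      obtain rfl : k = k' := by omega
      obtain ⟨s'', t', hr', ht', hQ⟩ := ih hI
      refine ⟨s'', t + t' + 1, .loopMore _ _ _ _ _ _ _ hb hr hr', ?_, hQ⟩
      rw [Nat.succ_mul]
      omega
    · exact ⟨s, 1, .loopDone _ _ _ hb, by omega, hb, _, h⟩

end Ensures

/-- The integer variable stored at the entry `0, 0` of an array. -/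
def NatExpr.var (a : NatArray) : NatExpr := .read a (.const 0) (.const 0)

/-- The entry `i, 0` of an array. -/
def NatExpr.entry (a : NatArray) (i : NatExpr) : NatExpr := .read a i (.const 0)

/-- The entry `i, 0` of an array of real numbers. -/
def RealExpr.entry (a : RealArray) (i : NatExpr) : RealExpr := .read a i (.const 0)

/-- Run `P` with the variable `a` equal to `0`, …, `b - 1`. -/
def Program.forLoop (a : NatArray) (b : NatExpr) (P : Program) : Program :=
  .seq (.setNat a (.const 0) (.const 0) (.const 0))
    (.loop (.natLt (.var a) b)
      (.seq P (.setNat a (.const 0) (.const 0) (.add (.var a) (.const 1)))))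

@[simp] theorem NatExpr.eval_const (s : Store) (k : ℕ) : (NatExpr.const k).eval s = k := rfl

@[simp] theorem NatExpr.eval_var (s : Store) (a : NatArray) :
    (NatExpr.var a).eval s = s.nat a 0 0 := rfl

@[simp] theorem NatExpr.eval_entry (s : Store) (a : NatArray) (i : NatExpr) :
    (NatExpr.entry a i).eval s = s.nat a (i.eval s) 0 := rfl

@[simp] theorem RealExpr.eval_entry (s : Store) (a : RealArray) (i : NatExpr) :
    (RealExpr.entry a i).eval s = s.real a (i.eval s) 0 := rfl

@[simp] theorem Store.setNat_real (s : Store) (a : NatArray) (i j x : ℕ) :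
    (s.setNat a i j x).real = s.real := rfl

@[simp] theorem Store.setReal_nat (s : Store) (a : RealArray) (i j : ℕ) (x : ℝ) :
    (s.setReal a i j x).nat = s.nat := rfl

@[simp] theorem Store.setNat_nat_self (s : Store) (a : NatArray) (i j x i' j' : ℕ) :
    (s.setNat a i j x).nat a i' j' = if i' = i ∧ j' = j then x else s.nat a i' j' := by
  simp [Store.setNat]

@[simp] theorem Store.setReal_real_self (s : Store) (a : RealArray) (i j : ℕ) (x : ℝ)
    (i' j' : ℕ) :
    (s.setReal a i j x).real a i' j' = if i' = i ∧ j' = j then x else s.real a i' j' := by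
  simp [Store.setReal]

theorem Store.setNat_nat_of_ne (s : Store) {a a' : NatArray} (h : a' ≠ a) (i j x : ℕ) :
    (s.setNat a i j x).nat a' = s.nat a' := by
  funext i' j'
  simp [Store.setNat, h]

theorem Store.setReal_real_of_ne (s : Store) {a a' : RealArray} (h : a' ≠ a) (i j : ℕ) (x : ℝ) :
    (s.setReal a i j x).real a' = s.real a' := by
  funext i' j'
  simp [Store.setReal, h]

/-- Each pass costs the body plus one test and one increment; the final 2 pays for the
initialization and the failing test. -/
theorem Ensures.forLoop {a : NatArray} {b : NatExpr} {P : Program} {T K : ℕ}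
    {Inv : ℕ → Store → Prop} {s : Store}
    (bound : ∀ k s, Inv k s → b.eval s = K)
    (start : Inv 0 (s.setNat a 0 0 0))
    (body : ∀ k < K, ∀ s, s.nat a 0 0 = k → Inv k s →
      Ensures oracle P T s (fun s' => s'.nat a 0 0 = k ∧ Inv (k + 1) (s'.setNat a 0 0 (k + 1)))) :
    Ensures oracle (.forLoop a b P) (K * (T + 2) + 2) s (fun s' => Inv K s') := by
  have main : Ensures oracle
      (.loop (.natLt (.var a) b)
        (.seq P (.setNat a (.const 0) (.const 0) (.add (.var a) (.const 1)))))
      (K * (T + 1 + 1) + 1) (s.setNat a 0 0 0) (fun s' => ¬ s'.nat a 0 0 < b.eval s' ∧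
        ∃ r k, r + k = K ∧ s'.nat a 0 0 = k ∧ Inv k s') := by
    refine Ensures.loop (Inv := fun r s => ∃ k, r + k = K ∧ s.nat a 0 0 = k ∧ Inv k s) ?_ K
      ⟨0, by simp, by simp, start⟩
    rintro r s ⟨k, hr, hk, hI⟩ hb
    have hb' : s.nat a 0 0 < b.eval s := hb
    rw [bound k s hI, hk] at hb'
    refine ⟨r - 1, by omega, (Ensures.seq (body k hb' s hk hI) ?_)⟩
    rintro s' ⟨hk', hI'⟩
    refine Ensures.setNat ⟨k + 1, by omega, ?_, ?_⟩
    · simp [NatExpr.eval, NatExpr.var, hk']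
    · simpa [NatExpr.eval, NatExpr.var, hk'] using hI'
  refine (Ensures.seq (R := fun s' => s' = s.setNat a 0 0 0) (Ensures.setNat rfl) ?_).mono
    (T := 1 + (K * (T + 1 + 1) + 1)) (by rw [show T + 1 + 1 = T + 2 from rfl]; omega)
    (fun s' h => h)
  rintro s' rfl
  refine main.mono le_rfl ?_
  rintro s' ⟨hb, r, k, hr, hk, hI⟩
  have : k = K := by
    rw [bound k s' hI, hk] at hb
    omega
  rwa [← this]

/-- The memories `s` and `s'` agree, apart from some arrays of natural numbers and of real
numbers. -/
def SameExcept (A : List NatArray) (R : List RealArray) (s s' : Store) : Prop :=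
  (∀ a, a ∉ A → s'.nat a = s.nat a) ∧ ∀ r, r ∉ R → s'.real r = s.real r

namespace SameExcept

theorem refl (A : List NatArray) (R : List RealArray) (s : Store) : SameExcept A R s s :=
  ⟨fun _ _ => rfl, fun _ _ => rfl⟩

theorem trans {A A' : List NatArray} {R R' : List RealArray} {s s' s'' : Store}
    (h : SameExcept A R s s') (h' : SameExcept A' R' s' s'') (hA : A' ⊆ A) (hR : R' ⊆ R) :
    SameExcept A R s s'' :=
  ⟨fun a ha => (h'.1 a fun hc => ha (hA hc)).trans (h.1 a ha),
    fun r hr => (h'.2 r fun hc => hr (hR hc)).trans (h.2 r hr)⟩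

theorem setNat {A : List NatArray} {R : List RealArray} {s s' : Store}
    (h : SameExcept A R s s') {a : NatArray} (ha : a ∈ A) (i j x : ℕ) :
    SameExcept A R s (s'.setNat a i j x) :=
  ⟨fun b hb => (s'.setNat_nat_of_ne (by rintro rfl; exact hb ha) i j x).trans (h.1 b hb), h.2⟩

theorem setReal {A : List NatArray} {R : List RealArray} {s s' : Store}
    (h : SameExcept A R s s') {r : RealArray} (hr : r ∈ R) (i j : ℕ) (x : ℝ) :
    SameExcept A R s (s'.setReal r i j x) :=
  ⟨h.1, fun b hb => (s'.setReal_real_of_ne (by rintro rfl; exact hb hr) i j x).trans (h.2 b hb)⟩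

end SameExcept

end

/-! ### The primal-dual program -/

namespace PrimalDual

/-- The current edge. -/
abbrev edgeVar : NatArray := .work 0
/-- The current core. -/
abbrev coreVar : NatArray := .work 1
/-- The number of cores covered by the current edge. -/
abbrev degree : NatArray := .work 2
/-- One more than the best edge found so far; zero if there is none. -/
abbrev best : NatArray := .work 3
/-- The number of edges added so far. -/
abbrev count : NatArray := .work 4
/-- The edges added so far, in this order. -/
abbrev order : NatArray := .work 5
/-- The left-hand sides of the dual constraints. -/
abbrev load : RealArray := .work 0
/-- The amount by which the dual variables of the cores are raised. -/
abbrev amount : RealArray := .work 1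

/-- Assign to an integer variable. -/
def assign (a : NatArray) (x : NatExpr) : Program := .setNat a (.const 0) (.const 0) x

/-- The current edge covers the current core. -/
def coversTest : Test :=
  .neg (.natEq (.read .core (.var coreVar) (.entry .tail (.var edgeVar)))
    (.read .core (.var coreVar) (.entry .head (.var edgeVar))))

/-- Count the cores covered by the current edge. -/
def countCores : Program :=
  .seq (assign degree (.const 0))
    (.forLoop coreVar (.var .numCores)
      (.ite coversTest (assign degree (.add (.var degree) (.const 1))) .skip))

/-- The raise at which the current edge becomes tight. -/
def slackRatio : RealExpr :=
  .divNat (.sub (.entry .cost (.var edgeVar)) (.entry load (.var edgeVar))) (.var degree)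

/-- Compare the current edge with the best edge so far. -/
def compareEdge : Program :=
  .ite (.natLt (.const 0) (.var degree))
    (.ite (.conj (.natLt (.const 0) (.var best))
        (.neg (.realLt slackRatio (.entry amount (.const 0)))))
      .skip
      (.seq (.setReal amount (.const 0) (.const 0) slackRatio)
        (assign best (.add (.var edgeVar) (.const 1)))))
    .skip

/-- Find the edge that becomes tight first. -/
def selectEdge : Program :=
  .seq (assign best (.const 0))
    (.forLoop edgeVar (.var .numEdges)
      (.ite (.natEq (.entry .query (.var edgeVar)) (.const 0)) (.seq countCores compareEdge) .skip))

/-- Raise the dual variables of all cores. -/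
def raiseLoads : Program :=
  .forLoop edgeVar (.var .numEdges)
    (.forLoop coreVar (.var .numCores)
      (.ite coversTest
        (.setReal load (.var edgeVar) (.const 0)
          (.add (.entry load (.var edgeVar)) (.entry amount (.const 0))))
        .skip))

/-- Add the selected edge. -/
def addEdge : Program :=
  .seq (.setNat .query (.sub (.var best) (.const 1)) (.const 0) (.const 1))
    (.seq (.setNat order (.var count) (.const 0) (.sub (.var best) (.const 1)))
      (assign count (.add (.var count) (.const 1))))

/-- The first phase. -/
def firstPhase : Program :=
  .seq .askCores
    (.loop (.neg (.natEq (.var .numCores) (.const 0)))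
      (.seq selectEdge (.seq raiseLoads (.seq addEdge .askCores))))

/-- The second phase. -/
def secondPhase : Program :=
  .loop (.natLt (.const 0) (.var count))
    (.seq (assign count (.sub (.var count) (.const 1)))
      (.seq (.setNat .query (.entry order (.var count)) (.const 0) (.const 0))
        (.seq .askCores
          (.ite (.natEq (.var .numCores) (.const 0)) .skip
            (.setNat .query (.entry order (.var count)) (.const 0) (.const 1))))))

/-- Copy the current edge set to the output. -/
def writeOutput : Program :=
  .forLoop edgeVar (.var .numEdges)
    (.setNat .output (.var edgeVar) (.const 0) (.entry .query (.var edgeVar)))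

/-- The primal-dual algorithm with reverse delete. -/
def program : Program := .seq firstPhase (.seq secondPhase writeOutput)

end PrimalDual

/-! ### Memory invariants and edge selection -/

section

variable {n m : ℕ} {N : Network (Fin n) (Fin m)} {F : Finset (Finset (Fin n))}
  {oracle : Finset (Fin m) → List (Finset (Fin n))}

/-- The memory contains the network. -/
structure Network.InputIn (N : Network (Fin n) (Fin m)) (s : Store) : Prop where
  numEdges : s.nat .numEdges 0 0 = m
  tail : ∀ e : Fin m, s.nat .tail e 0 = N.tail e
  head : ∀ e : Fin m, s.nat .head e 0 = N.head e
  cost : ∀ e : Fin m, s.real .cost e 0 = N.cost e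

theorem Network.InputIn.of_same {A : List NatArray} {R : List RealArray} {s s' : Store}
    (h : N.InputIn s) (hs : SameExcept A R s s')
    (hA : ∀ a ∈ [NatArray.numEdges, .tail, .head], a ∉ A) (hR : RealArray.cost ∉ R) :
    N.InputIn s' where
  numEdges := by rw [hs.1 _ (hA _ (by simp)), h.numEdges]
  tail e := by rw [hs.1 _ (hA _ (by simp)), h.tail]
  head e := by rw [hs.1 _ (hA _ (by simp)), h.head]
  cost e := by rw [hs.2 _ hR, h.cost]

/-- The memory contains the answer `L` of the oracle. -/
structure CoresIn (L : List (Finset (Fin n))) (s : Store) : Prop where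
  numCores : s.nat .numCores 0 0 = L.length
  core : ∀ k (hk : k < L.length) (v : Fin n), s.nat .core k v = if v ∈ L[k] then 1 else 0

theorem CoresIn.of_same {L : List (Finset (Fin n))} {A : List NatArray} {R : List RealArray}
    {s s' : Store} (h : CoresIn L s) (hs : SameExcept A R s s')
    (hA : ∀ a ∈ [NatArray.numCores, .core], a ∉ A) : CoresIn L s' where
  numCores := by rw [hs.1 _ (hA _ (by simp)), h.numCores]
  core k hk v := by rw [hs.1 _ (hA _ (by simp)), h.core k hk]

theorem Ensures.askCores {s : Store} (hlen : (oracle (s.edgeSet m .query)).length ≤ n) :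
    Ensures oracle .askCores (1 + m + n * n) s (fun s' =>
      SameExcept [.numCores, .core] [] s s' ∧ CoresIn (oracle (s.edgeSet m .query)) s') := by
  refine ⟨_, _, .askCores s, by gcongr, ⟨fun a ha => ?_, fun r hr => rfl⟩, ?_, fun k hk v => ?_⟩
  · simp only [List.mem_cons, List.not_mem_nil, or_false, not_or] at ha
    funext i j
    simp [Store.writeCores, ha.1, ha.2]
  · simp [Store.writeCores]
  · simp [Store.writeCores, hk]

/-- The number of members of `L` that the edge `e` covers. -/
def Network.coverCount (N : Network (Fin n) (Fin m)) (L : List (Finset (Fin n))) (e : Fin m) : ℕ :=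
  L.countP fun C => N.Covers e C

theorem Network.coverCount_take_succ (L : List (Finset (Fin n))) (e : Fin m) {k : ℕ}
    (hk : k < L.length) :
    N.coverCount (L.take (k + 1)) e = N.coverCount (L.take k) e +
      if N.Covers e L[k] then 1 else 0 := by
  rw [coverCount, List.take_succ_eq_append_getElem hk, List.countP_append]
  simp [coverCount, List.countP_cons]

theorem Network.coverCount_eq_card {L : List (Finset (Fin n))} (hL : L.Nodup) (e : Fin m) :
    N.coverCount L e = (L.toFinset.filter fun C => N.Covers e C).card := by
  rw [coverCount, List.countP_eq_length_filter, ← List.toFinset_card_of_nodup (hL.filter _),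
    List.toFinset_filter]
  simp

namespace PrimalDual

theorem coversTest_holds {s : Store} (hN : N.InputIn s) {L : List (Finset (Fin n))}
    (hL : CoresIn L s) {e : Fin m} (he : s.nat edgeVar 0 0 = e) {k : ℕ} (hk : k < L.length)
    (hj : s.nat coreVar 0 0 = k) : coversTest.holds s ↔ N.Covers e L[k] := by
  have h1 : coversTest.holds s ↔
      ¬ s.nat .core (s.nat coreVar 0 0) (s.nat .tail (s.nat edgeVar 0 0) 0) =
        s.nat .core (s.nat coreVar 0 0) (s.nat .head (s.nat edgeVar 0 0) 0) := Iff.rfl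
  rw [h1, he, hj, hN.tail, hN.head, hL.core k hk, hL.core k hk]
  unfold Network.Covers
  split_ifs <;> simp_all

theorem countCores_spec {s : Store} (hN : N.InputIn s) {L : List (Finset (Fin n))}
    (hL : CoresIn L s) (hlen : L.length ≤ n) {e : Fin m} (he : s.nat edgeVar 0 0 = e) :
    Ensures oracle countCores (4 * n + 3) s (fun s' =>
      SameExcept [coreVar, degree] [] s s' ∧ s'.nat degree 0 0 = N.coverCount L e) := by
  refine (Ensures.seq (R := fun s' => s' = s.setNat degree 0 0 0) (Ensures.setNat rfl)
    (T' := L.length * (2 + 2) + 2) ?_).mono (by omega) (fun _ h => h)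
  rintro s' rfl
  refine (Ensures.forLoop (Inv := fun k s' => SameExcept [coreVar, degree] [] s s' ∧
    s'.nat degree 0 0 = N.coverCount (L.take k) e) ?_ ?_ ?_).mono le_rfl ?_
  · rintro k s' ⟨hs, -⟩
    simpa using (hL.of_same hs (by decide)).numCores
  · refine ⟨((SameExcept.refl _ _ s).setNat (by decide) _ _ _).setNat (by decide) _ _ _, ?_⟩
    simp [Store.setNat_nat_of_ne, Network.coverCount]
  · rintro k hk s' hj ⟨hs, hdeg⟩
    have he' : s'.nat edgeVar 0 0 = e := by rw [hs.1 _ (by decide), he]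
    have htest := coversTest_holds (hN.of_same hs (by decide) (by decide))
      (hL.of_same hs (by decide)) he' hk hj
    rw [Network.coverCount_take_succ L e hk]
    refine Ensures.ite (T := 1) (fun hb => Ensures.setNat ⟨?_, ?_, ?_⟩)
      (fun hb => Ensures.skip ⟨hj, ?_, ?_⟩)
    · simp [Store.setNat_nat_of_ne, hj]
    · exact (hs.setNat (by decide) _ _ _).setNat (by decide) _ _ _
    · rw [if_pos (htest.1 hb)]
      simp [Store.setNat_nat_of_ne, NatExpr.eval, NatExpr.var, hdeg]
    · exact hs.setNat (by decide) _ _ _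
    · rw [if_neg (mt htest.2 hb)]
      simp [Store.setNat_nat_of_ne, hdeg]
  · rintro s' ⟨hs, hdeg⟩
    exact ⟨hs, by simpa using hdeg⟩

/-- Among the edges with number less than `k` that are not in `I` and cover a member of `L`, the
edge stored in `best` minimizes the ratio of slack and number of covered sets. -/
def BestIn (N : Network (Fin n) (Fin m)) (L : List (Finset (Fin n))) (I : Finset (Fin m))
    (ld : Fin m → ℝ) (k : ℕ) (s : Store) : Prop :=
  (s.nat best 0 0 = 0 ∧ ∀ f : Fin m, f < k → f ∉ I → N.coverCount L f = 0) ∨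
  ∃ b : Fin m, s.nat best 0 0 = b + 1 ∧ b ∉ I ∧ 0 < N.coverCount L b ∧
    s.real amount 0 0 = (N.cost b - ld b) / N.coverCount L b ∧
    ∀ f : Fin m, f < k → f ∉ I → 0 < N.coverCount L f →
      s.real amount 0 0 ≤ (N.cost f - ld f) / N.coverCount L f

theorem BestIn.of_same {L : List (Finset (Fin n))} {I : Finset (Fin m)} {ld : Fin m → ℝ} {k : ℕ}
    {A : List NatArray} {R : List RealArray} {s s' : Store} (h : BestIn N L I ld k s)
    (hs : SameExcept A R s s') (hA : best ∉ A) (hR : amount ∉ R) : BestIn N L I ld k s' := by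
  unfold BestIn
  rwa [hs.1 _ hA, hs.2 _ hR]

theorem BestIn.succ_of_not {L : List (Finset (Fin n))} {I : Finset (Fin m)} {ld : Fin m → ℝ}
    {s : Store} {e : Fin m} (h : BestIn N L I ld e s)
    (he : e ∉ I → 0 < N.coverCount L e → s.nat best 0 0 ≠ 0 ∧
      s.real amount 0 0 ≤ (N.cost e - ld e) / N.coverCount L e) :
    BestIn N L I ld (e + 1) s := by
  rcases h with ⟨h0, h⟩ | ⟨b, hb, hbI, hpos, hval, h⟩
  · refine .inl ⟨h0, fun f hf hfI => ?_⟩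
    rcases Nat.lt_succ_iff_lt_or_eq.1 hf with hf | hf
    · exact h f hf hfI
    · obtain rfl := Fin.ext hf
      by_contra hc
      exact (he hfI (Nat.pos_of_ne_zero hc)).1 h0
  · refine .inr ⟨b, hb, hbI, hpos, hval, fun f hf hfI hfpos => ?_⟩
    rcases Nat.lt_succ_iff_lt_or_eq.1 hf with hf | hf
    · exact h f hf hfI hfpos
    · obtain rfl := Fin.ext hf
      exact (he hfI hfpos).2

theorem compareEdge_spec {s : Store} (hN : N.InputIn s) {L : List (Finset (Fin n))}
    {I : Finset (Fin m)} {ld : Fin m → ℝ} (hld : ∀ e : Fin m, s.real load e 0 = ld e) {e : Fin m}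
    (he : s.nat edgeVar 0 0 = e) (heI : e ∉ I) (hdeg : s.nat degree 0 0 = N.coverCount L e)
    (hbest : BestIn N L I ld e s) :
    Ensures oracle compareEdge 4 s (fun s' =>
      SameExcept [best] [amount] s s' ∧ BestIn N L I ld (e + 1) s') := by
  have hratio : slackRatio.eval s = (N.cost e - ld e) / N.coverCount L e := by
    simp [slackRatio, RealExpr.eval, he, hdeg, hN.cost, hld]
  refine Ensures.ite (T := 3) (fun hpos => ?_) (fun hpos => ?_)
  · have hpos' : 0 < N.coverCount L e := by rw [← hdeg]; exact hpos
    refine Ensures.ite (T := 2) (fun hb => ?_) (fun hb => ?_)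
    · refine (Ensures.skip ⟨SameExcept.refl _ _ _, hbest.succ_of_not fun _ _ => ?_⟩).mono
        (by omega) (fun _ h => h)
      obtain ⟨hb1, hb2⟩ := hb
      have hb1 : 0 < s.nat best 0 0 := hb1
      have hb2 : ¬ slackRatio.eval s < s.real amount 0 0 := hb2
      rw [hratio] at hb2
      exact ⟨hb1.ne', not_lt.1 hb2⟩
    · have hb' : 0 < s.nat best 0 0 → slackRatio.eval s < s.real amount 0 0 := by
        intro h1
        by_contra h2
        exact hb ⟨h1, h2⟩
      rw [hratio] at hb'
      refine Ensures.seq (T := 1) (T' := 1)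
        (R := fun s' => s' = s.setReal amount 0 0 ((N.cost e - ld e) / N.coverCount L e)) ?_ ?_
      · exact Ensures.setReal (by simp [hratio])
      · rintro s' rfl
        refine Ensures.setNat ⟨?_, .inr ⟨e, ?_, heI, hpos', ?_, fun f hf hfI hfpos => ?_⟩⟩
        · exact ((SameExcept.refl _ _ s).setReal (by decide) _ _ _).setNat (by decide) _ _ _
        · simp [NatExpr.eval, NatExpr.var, he]
        · simp
        · simp only [Store.setNat_real, Store.setReal_real_self, and_self, if_true]
          rcases Nat.lt_succ_iff_lt_or_eq.1 hf with hf | hf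
          · rcases hbest with ⟨-, h⟩ | ⟨b, hb, -, -, -, h⟩
            · exact absurd (h f hf hfI) hfpos.ne'
            · exact (hb' (by omega)).le.trans (h f hf hfI hfpos)
          · obtain rfl := Fin.ext hf
            exact le_rfl
  · refine (Ensures.skip ⟨SameExcept.refl _ _ _, hbest.succ_of_not fun _ h => ?_⟩).mono
      (by omega) (fun _ h => h)
    rw [← hdeg] at h
    exact absurd h hpos

theorem selectEdge_spec {s : Store} (hN : N.InputIn s) {L : List (Finset (Fin n))}
    (hL : CoresIn L s) (hlen : L.length ≤ n) {I : Finset (Fin m)}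
    (hI : s.edgeSet m .query = I) {ld : Fin m → ℝ} (hld : ∀ e : Fin m, s.real load e 0 = ld e) :
    Ensures oracle selectEdge (m * (4 * n + 10) + 3) s (fun s' =>
      SameExcept [edgeVar, coreVar, degree, best] [amount] s s' ∧ BestIn N L I ld m s') := by
  have hI' : ∀ e : Fin m, s.nat .query e 0 = 0 ↔ e ∉ I := fun e => by
    rw [← hI]; simp [Store.edgeSet]
  refine (Ensures.seq (R := fun s' => s' = s.setNat best 0 0 0) (Ensures.setNat rfl)
    (T' := m * (4 * n + 8 + 2) + 2) ?_).mono (by ring_nf; omega) (fun _ h => h)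
  rintro s' rfl
  refine (Ensures.forLoop (Inv := fun k s' =>
    SameExcept [edgeVar, coreVar, degree, best] [amount] s s' ∧ BestIn N L I ld k s')
    ?_ ?_ ?_).mono le_rfl ?_
  · rintro k s' ⟨hs, -⟩
    simpa using (hN.of_same hs (by decide) (by decide)).numEdges
  · refine ⟨((SameExcept.refl _ _ s).setNat (by decide) _ _ _).setNat (by decide) _ _ _,
      .inl ⟨?_, by simp⟩⟩
    simp [Store.setNat_nat_of_ne]
  · rintro k hk s' he ⟨hs, hb⟩
    have hN' := hN.of_same hs (by decide) (by decide)
    have hL' := hL.of_same hs (by decide)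
    set e : Fin m := ⟨k, hk⟩ with hedef
    have he' : s'.nat edgeVar 0 0 = e := he
    have hq : s'.nat .query e 0 = 0 ↔ e ∉ I := by rw [hs.1 _ (by decide), hI']
    have hld' : ∀ e : Fin m, s'.real load e 0 = ld e := fun e => by
      rw [hs.2 _ (by decide), hld]
    refine Ensures.ite (T := 4 * n + 7) (fun ht => ?_) (fun ht => ?_)
    · have ht' : s'.nat .query (s'.nat edgeVar 0 0) 0 = 0 := ht
      rw [he', hq] at ht'
      refine Ensures.seq (T := 4 * n + 3) (T' := 4) (countCores_spec hN' hL' hlen he') ?_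
      rintro s'' ⟨hs', hdeg⟩
      refine (compareEdge_spec (hN'.of_same hs' (by decide) (by decide)) (ld := ld) (L := L)
        (I := I) (fun e => ?_) (e := e) ?_ ht' hdeg
        (hb.of_same hs' (by decide) (by decide))).mono le_rfl ?_
      · rw [hs'.2 _ (by decide), hld']
      · rw [hs'.1 _ (by decide), he']
      · rintro s₃ ⟨hs₃, hb₃⟩
        have hall := (hs.trans hs' (by decide) (by decide)).trans hs₃ (by decide) (by decide)
        refine ⟨?_, hall.setNat (by decide) _ _ _, hb₃.of_same
          ((SameExcept.refl [edgeVar] [] s₃).setNat (by decide) _ _ _) (by decide) (by decide)⟩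
        rw [hs₃.1 _ (by decide), hs'.1 _ (by decide), he]
    · have ht' : ¬ s'.nat .query (s'.nat edgeVar 0 0) 0 = 0 := ht
      rw [he', hq] at ht'
      refine (Ensures.skip ⟨he, hs.setNat (by decide) _ _ _, ?_⟩).mono (by omega) (fun _ h => h)
      exact BestIn.of_same (hb.succ_of_not (e := e) fun h => absurd h ht')
        ((SameExcept.refl [edgeVar] [] s').setNat (by decide) _ _ _) (by decide) (by decide)
  · exact fun s' h => h

/-- Adding ε once for every covered core updates the loads exactly as raising the dual variables
would, without storing these variables. -/
theorem raiseLoads_spec {s : Store} (hN : N.InputIn s) {L : List (Finset (Fin n))}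
    (hL : CoresIn L s) (hlen : L.length ≤ n) {ld : Fin m → ℝ} {ε : ℝ}
    (hld : ∀ e : Fin m, s.real load e 0 = ld e) (hε : s.real amount 0 0 = ε) :
    Ensures oracle raiseLoads (m * (4 * n + 4) + 2) s (fun s' =>
      SameExcept [edgeVar, coreVar] [load] s s' ∧
      ∀ e : Fin m, s'.real load e 0 = ld e + N.coverCount L e * ε) := by
  refine (Ensures.forLoop (T := 4 * n + 2) (Inv := fun k s' =>
    SameExcept [edgeVar, coreVar] [load] s s' ∧
    ∀ e : Fin m, s'.real load e 0 = ld e + if (e : ℕ) < k then N.coverCount L e * ε else 0)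
    ?_ ?_ ?_).mono le_rfl ?_
  · rintro k s' ⟨hs, -⟩
    simpa using (hN.of_same hs (by decide) (by decide)).numEdges
  · exact ⟨(SameExcept.refl _ _ s).setNat (by decide) _ _ _, fun e => by simp [hld]⟩
  · rintro k hk s' he ⟨hs, hld'⟩
    set e : Fin m := ⟨k, hk⟩ with hedef
    -- Inner invariant: edges before `k` are finished, edge `k` has received its share from the
    -- first `j` cores, later edges are untouched.
    refine (Ensures.forLoop (T := 2) (K := L.length) (Inv := fun j s' =>
      SameExcept [edgeVar, coreVar] [load] s s' ∧ s'.nat edgeVar 0 0 = e ∧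
      ∀ f : Fin m, s'.real load f 0 = ld f + if (f : ℕ) < k then N.coverCount L f * ε else
        if f = e then N.coverCount (L.take j) e * ε else 0)
      ?_ ?_ ?_).mono (by omega) ?_
    · rintro j s'' ⟨hs', -⟩
      simpa using (hL.of_same hs' (by decide)).numCores
    · refine ⟨hs.setNat (by decide) _ _ _, by simpa [Store.setNat_nat_of_ne] using he, fun f => ?_⟩
      simp [hld', Network.coverCount]
    · rintro j hj s'' hj' ⟨hs', he', hld''⟩
      have htest := coversTest_holds (hN.of_same hs' (by decide) (by decide))
        (hL.of_same hs' (by decide)) he' hj hj'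
      rw [Network.coverCount_take_succ L e hj]
      refine Ensures.ite (T := 1) (fun hb => Ensures.setReal ⟨?_, ?_, ?_, fun f => ?_⟩)
        (fun hb => Ensures.skip ⟨hj', ?_, ?_, fun f => ?_⟩)
      · simpa using hj'
      · exact (hs'.setReal (by decide) _ _ _).setNat (by decide) _ _ _
      · simpa [Store.setNat_nat_of_ne] using he'
      · have hε' : s''.real amount 0 0 = ε := by rw [hs'.2 _ (by decide), hε]
        simp only [Store.setNat_real, NatExpr.eval_var, NatExpr.eval_const, RealExpr.eval,
          RealExpr.eval_entry, Store.setReal_real_self, he', hε', hld'', Fin.val_inj, and_true]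
        by_cases hfe : f = e
        · subst hfe
          have hek : ¬ (e : ℕ) < k := by simp [hedef]
          simp only [hek, if_true, if_false, if_pos (htest.1 hb)]
          push_cast
          ring
        · simp [hfe]
      · exact hs'.setNat (by decide) _ _ _
      · simpa [Store.setNat_nat_of_ne] using he'
      · rw [if_neg (mt htest.2 hb)]
        simpa using hld'' f
    · rintro s'' ⟨hs', he', hld''⟩
      refine ⟨he', hs'.setNat (by decide) _ _ _, fun f => ?_⟩
      rw [Store.setNat_real, hld'' f, List.take_length]
      by_cases h1 : (f : ℕ) < k
      · simp [h1, Nat.lt_succ_of_lt h1]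
      · by_cases h2 : f = e
        · subst h2
          simp [hedef]
        · have h3 : ¬ (f : ℕ) < k + 1 := fun h3 => h2 (Fin.ext (by simp only [hedef]; omega))
          simp [h1, h2, h3]
  · rintro s' ⟨hs, hld'⟩
    exact ⟨hs, fun e => by simpa using hld' e⟩

end PrimalDual

end

/-! ### Minimum-ratio iterations, oracle answers and the record of the edge order -/

section

variable {n m : ℕ} {N : Network (Fin n) (Fin m)} {F : Finset (Finset (Fin n))}
  {oracle : Finset (Fin m) → List (Finset (Fin n))}

/-- Adding an edge with the least ratio of slack and number of covered cores is an iteration of the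
first phase. -/
theorem Phase1.step_of_ratio {V E : Type*} [Fintype V] [DecidableEq V] [Fintype E] [DecidableEq E]
    {N : Network V E} {F : Finset (Finset V)} {l : List E} {y : Finset V → ℝ}
    (h : Phase1 N F l y) (hne : (cores (N.residual F l.toFinset)).Nonempty) {b : E} (hb : b ∉ l)
    {d : E → ℕ} (hd : ∀ f, d f = ((cores (N.residual F l.toFinset)).filter
      fun C => N.Covers f C).card) (hpos : 0 < d b) {ε : ℝ}
    (hε : ε = (N.cost b - N.load F y b) / d b)
    (hmin : ∀ f, f ∉ l → 0 < d f → ε ≤ (N.cost f - N.load F y f) / d f) :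
    Phase1 N F (b :: l) (raise y (cores (N.residual F l.toFinset)) ε) := by
  have hsub : cores (N.residual F l.toFinset) ⊆ F :=
    fun C hC => (Network.mem_of_mem_cores_residual hC).1
  have hpos' : (0 : ℝ) < d b := by exact_mod_cast hpos
  have hval : (d b : ℝ) * ε = N.cost b - N.load F y b := by
    rw [hε]; field_simp
  refine .step l y b ε h hne hb ?_ (fun f hf => ?_) ?_ (fun ε' _ hε' => ?_)
  · rw [hε]
    exact div_nonneg (sub_nonneg.2 (h.load_le b)) hpos'.le
  · rw [Network.load_raise hsub, ← hd]
    rcases Nat.eq_zero_or_pos (d f) with h0 | h0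
    · simpa [h0] using h.load_le f
    · have h0' : (0 : ℝ) < d f := by exact_mod_cast h0
      have := (le_div_iff₀ h0').1 (hmin f hf h0)
      linarith
  · unfold Network.Tight
    rw [Network.load_raise hsub, ← hd, hval]
    ring
  -- Since `b` covers a core, its load grows strictly with the raise, so it is not tight earlier.
  · unfold Network.Tight
    rw [Network.load_raise hsub, ← hd]
    have := mul_lt_mul_of_pos_left hε' hpos'
    intro hc
    linarith

/-- Cores are nonempty and pairwise disjoint. This keeps the oracle's answers, and with them the
inner loops, polynomial. -/
theorem Pliable.card_cores_le {V : Type*} [Fintype V] [DecidableEq V] {H : Finset (Finset V)}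
    (hH : Pliable H) (h0 : ∅ ∉ H) : (cores H).card ≤ Fintype.card V := by
  calc (cores H).card = ∑ C ∈ cores H, 1 := by simp
    _ ≤ ∑ C ∈ cores H, C.card := Finset.sum_le_sum fun C hC => by
        rw [Nat.one_le_iff_ne_zero, Ne, Finset.card_eq_zero]
        rintro rfl
        exact h0 (mem_cores.1 hC).1
    _ = ((cores H).biUnion id).card :=
        (Finset.card_biUnion fun C hC D hD hCD => hH.disjoint_cores hC hD hCD).symm
    _ ≤ Fintype.card V := Finset.card_le_univ _

theorem Network.CoreOracle.length_le (ho : N.CoreOracle F oracle) (hF : N.GammaPliable F)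
    (hcov : N.CoversFamily F Finset.univ) (I : Finset (Fin m)) : (oracle I).length ≤ n := by
  rw [← List.toFinset_card_of_nodup (ho I).1, (ho I).2]
  simpa using (hF.1.residual (N := N) I).card_cores_le fun h0 => by
    obtain ⟨e, -, he⟩ := Network.coversFamily_iff.1 hcov _ (Network.mem_residual.1 h0).1
    simp [Network.Covers] at he

theorem Network.CoreOracle.coverCount_eq (ho : N.CoreOracle F oracle) (I : Finset (Fin m))
    (e : Fin m) : N.coverCount (oracle I) e =
      ((cores (N.residual F I)).filter fun C => N.Covers e C).card := by
  rw [Network.coverCount_eq_card (ho I).1, (ho I).2]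

theorem Network.CoreOracle.length_eq_zero_iff (ho : N.CoreOracle F oracle) (I : Finset (Fin m)) :
    (oracle I).length = 0 ↔ cores (N.residual F I) = ∅ := by
  rw [List.length_eq_zero_iff, ← (ho I).2, List.toFinset_eq_empty_iff]

theorem Network.CoreOracle.exists_coverCount_pos (ho : N.CoreOracle F oracle)
    (hcov : N.CoversFamily F Finset.univ) {I : Finset (Fin m)}
    (hne : (cores (N.residual F I)).Nonempty) : ∃ e ∉ I, 0 < N.coverCount (oracle I) e := by
  obtain ⟨C, hC⟩ := hne
  obtain ⟨hCF, hCI⟩ := Network.mem_of_mem_cores_residual hC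
  obtain ⟨e, -, he⟩ := Network.coversFamily_iff.1 hcov C hCF
  refine ⟨e, fun heI => hCI e heI he, ?_⟩
  rw [ho.coverCount_eq, Finset.card_pos]
  exact ⟨C, Finset.mem_filter.2 ⟨hC, he⟩⟩

namespace PrimalDual

/-- The memory contains the edges of `l`, in the reverse order. -/
structure OrderIn (l : List (Fin m)) (s : Store) : Prop where
  length_eq : s.nat count 0 0 = l.length
  entry_eq : ∀ (i : ℕ) (e : Fin m), l.reverse[i]? = some e → s.nat order i 0 = (e : ℕ)

theorem OrderIn.of_same {l : List (Fin m)} {A : List NatArray} {R : List RealArray}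
    {s s' : Store} (h : OrderIn l s) (hs : SameExcept A R s s')
    (hA : ∀ a ∈ [count, order], a ∉ A) : OrderIn l s' where
  length_eq := by rw [hs.1 _ (hA _ (by simp)), h.length_eq]
  entry_eq i e hie := by rw [hs.1 _ (hA _ (by simp)), h.entry_eq i e hie]

theorem edgeSet_of_same {A : List NatArray} {R : List RealArray} {s s' : Store}
    (hs : SameExcept A R s s') {a : NatArray} (ha : a ∉ A) :
    s'.edgeSet m a = s.edgeSet m a := by
  unfold Store.edgeSet
  rw [hs.1 a ha]

theorem edgeSet_setNat_one {s : Store} {I : Finset (Fin m)} {a : NatArray}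
    (hI : s.edgeSet m a = I) (e : Fin m) : (s.setNat a e 0 1).edgeSet m a = insert e I := by
  ext f
  rw [← hI]
  by_cases hfe : f = e
  · simp [Store.edgeSet, hfe]
  · simp [Store.edgeSet, hfe, Fin.val_inj]

theorem edgeSet_setNat_zero {s : Store} {I : Finset (Fin m)} {a : NatArray}
    (hI : s.edgeSet m a = I) (e : Fin m) : (s.setNat a e 0 0).edgeSet m a = I.erase e := by
  ext f
  rw [← hI]
  by_cases hfe : f = e
  · simp [Store.edgeSet, hfe]
  · simp [Store.edgeSet, hfe, Fin.val_inj]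

theorem addEdge_spec {s : Store} {l : List (Fin m)} {b : Fin m} (hb : s.nat best 0 0 = b + 1)
    (hI : s.edgeSet m .query = l.toFinset) (hl : OrderIn l s) :
    Ensures oracle addEdge 3 s (fun s' => SameExcept [.query, order, count] [] s s' ∧
      s'.edgeSet m .query = (b :: l).toFinset ∧ OrderIn (b :: l) s') := by
  refine Ensures.seq (T := 1) (T' := 2) (R := fun s' => s' = s.setNat .query b 0 1) ?_ ?_
  · exact Ensures.setNat (by simp [NatExpr.eval, NatExpr.var, hb])
  rintro _ rfl
  have h1 : SameExcept [.query] [] s (s.setNat .query b 0 1) :=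
    (SameExcept.refl _ _ s).setNat (by decide) _ _ _
  have h2 : SameExcept [.query, order, count] [] s (s.setNat .query b 0 1) :=
    (SameExcept.refl _ _ s).setNat (by decide) _ _ _
  have hl1 := hl.of_same h1 (by decide)
  have hI1 := edgeSet_setNat_one hI b
  have hb1 : (s.setNat .query b 0 1).nat best 0 0 = b + 1 := by rw [h1.1 _ (by decide), hb]
  generalize s.setNat .query b 0 1 = s₁ at *
  refine Ensures.seq (T := 1) (T' := 1) (R := fun s' => s' = s₁.setNat order l.length 0 b) ?_ ?_
  · refine Ensures.setNat ?_
    simp only [NatExpr.eval_var, NatExpr.eval, hb1, hl1.length_eq,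
      Nat.add_sub_cancel]
  rintro _ rfl
  refine Ensures.setNat ⟨?_, ?_, ?_, fun i e hie => ?_⟩
  · exact (h2.setNat (by decide) _ _ _).setNat (by decide) _ _ _
  · rw [List.toFinset_cons, ← hI1]
    exact edgeSet_of_same (A := [order, count]) (R := [])
      (((SameExcept.refl _ _ s₁).setNat (by decide) _ _ _).setNat (by decide) _ _ _) (by decide)
  · simp [NatExpr.eval, NatExpr.var, Store.setNat_nat_of_ne, hl1.length_eq]
  · rw [Store.setNat_nat_of_ne _ (by decide), Store.setNat_nat_self]
    rw [List.reverse_cons, List.getElem?_append, List.length_reverse] at hie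
    split_ifs at hie with hil
    · rw [if_neg (by simp; omega)]
      exact hl1.entry_eq i e hie
    · rw [List.getElem?_singleton] at hie
      split_ifs at hie with h0
      rw [if_pos ⟨by omega, rfl⟩]
      simpa [Fin.ext_iff] using hie

end PrimalDual
end

/-! ### Correctness and running time of the two phases -/

section

variable {n m : ℕ} {N : Network (Fin n) (Fin m)} {F : Finset (Finset (Fin n))}
  {oracle : Finset (Fin m) → List (Finset (Fin n))}

namespace PrimalDual

/-- The memory contains the state of the first phase after the edges of `l` have been added. -/
structure FirstPhaseState (N : Network (Fin n) (Fin m)) (F : Finset (Finset (Fin n)))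
    (oracle : Finset (Fin m) → List (Finset (Fin n))) (l : List (Fin m))
    (y : Finset (Fin n) → ℝ) (s : Store) : Prop where
  run : Phase1 N F l y
  input : N.InputIn s
  query : s.edgeSet m .query = l.toFinset
  order : OrderIn l s
  load : ∀ e : Fin m, s.real load e 0 = N.load F y e
  cores : CoresIn (oracle l.toFinset) s

theorem iteration_spec (ho : N.CoreOracle F oracle) (hF : N.GammaPliable F)
    (hcov : N.CoversFamily F Finset.univ) {l : List (Fin m)} {y : Finset (Fin n) → ℝ} {s : Store}
    (h : FirstPhaseState N F oracle l y s) (hne : s.nat .numCores 0 0 ≠ 0) :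
    Ensures oracle (.seq selectEdge (.seq raiseLoads (.seq addEdge .askCores)))
      (m * (4 * n + 10) + 3 + (m * (4 * n + 4) + 2 + (3 + (1 + m + n * n)))) s
      (fun s' => ∃ b y', FirstPhaseState N F oracle (b :: l) y' s') := by
  have hlen := ho.length_le hF hcov
  have hcores : (cores (N.residual F l.toFinset)).Nonempty := by
    rw [Finset.nonempty_iff_ne_empty, Ne, ← ho.length_eq_zero_iff, ← h.cores.numCores]
    exact hne
  refine Ensures.seq (selectEdge_spec h.input h.cores (hlen _) h.query h.load) ?_
  rintro s₁ ⟨hs₁, hbest⟩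
  obtain ⟨b, hb, hbl, hpos, hε, hmin⟩ : ∃ b : Fin m, s₁.nat best 0 0 = b + 1 ∧ b ∉ l.toFinset ∧
      0 < N.coverCount (oracle l.toFinset) b ∧
      s₁.real amount 0 0 = (N.cost b - N.load F y b) / N.coverCount (oracle l.toFinset) b ∧
      ∀ f : Fin m, f < m → f ∉ l.toFinset → 0 < N.coverCount (oracle l.toFinset) f →
        s₁.real amount 0 0 ≤ (N.cost f - N.load F y f) / N.coverCount (oracle l.toFinset) f := by
    -- The search cannot come back empty: all edges together cover every core, and selected edges
    -- cover none.
    refine hbest.resolve_left fun h0 => ?_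
    obtain ⟨e, he, hepos⟩ := ho.exists_coverCount_pos hcov hcores
    exact hepos.ne' (h0.2 e e.2 he)
  rw [List.mem_toFinset] at hbl
  have hrun := h.run.step_of_ratio hcores hbl (fun f => ho.coverCount_eq _ f) hpos hε
    (fun f hf hfpos => hmin f f.2 (by simpa using hf) hfpos)
  have hN₁ := h.input.of_same hs₁ (by decide) (by decide)
  refine Ensures.seq (raiseLoads_spec hN₁ (h.cores.of_same hs₁ (by decide)) (hlen _)
    (ld := N.load F y) (fun e => by rw [hs₁.2 _ (by decide), h.load]) rfl) ?_
  rintro s₂ ⟨hs₂, hload⟩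
  have hN₂ := hN₁.of_same hs₂ (by decide) (by decide)
  refine Ensures.seq (addEdge_spec (l := l) (b := b) ?_ ?_ ?_) ?_
  · rw [hs₂.1 _ (by decide), hb]
  · rw [edgeSet_of_same hs₂ (by decide), edgeSet_of_same hs₁ (by decide), h.query]
  · exact (h.order.of_same hs₁ (by decide)).of_same hs₂ (by decide)
  rintro s₃ ⟨hs₃, hq₃, ho₃⟩
  have hN₃ := hN₂.of_same hs₃ (by decide) (by decide)
  refine (Ensures.askCores (hlen _)).mono le_rfl ?_
  rintro s₄ ⟨hs₄, hcores₄⟩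
  refine ⟨b, _, hrun, hN₃.of_same hs₄ (by decide) (by decide), ?_, ho₃.of_same hs₄ (by decide),
    fun e => ?_, ?_⟩
  · rw [edgeSet_of_same hs₄ (by decide), hq₃]
  · rw [hs₄.2 _ (by decide), hs₃.2 _ (by decide), hload,
      Network.load_raise fun C hC => (Network.mem_of_mem_cores_residual hC).1, ho.coverCount_eq]
  · rwa [← hq₃]

/-- A bound for the number of steps of the first phase. -/
def firstPhaseTime (n m : ℕ) : ℕ :=
  1 + m + n * n + (m * (m * (4 * n + 10) + 3 +
    (m * (4 * n + 4) + 2 + (3 + (1 + m + n * n))) + 1) + 1)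

theorem firstPhase_spec (ho : N.CoreOracle F oracle) (hF : N.GammaPliable F)
    (hcov : N.CoversFamily F Finset.univ) {s : Store} (hN : N.InputIn s)
    (hq : s.edgeSet m .query = ∅) (hl : OrderIn ([] : List (Fin m)) s)
    (hload : ∀ e : Fin m, s.real load e 0 = 0) :
    Ensures oracle firstPhase (firstPhaseTime n m) s (fun s' => ∃ l y, Phase1 N F l y ∧
      cores (N.residual F l.toFinset) = ∅ ∧ N.InputIn s' ∧ s'.edgeSet m .query = l.toFinset ∧
      OrderIn l s') := by
  refine Ensures.seq (Ensures.askCores (ho.length_le hF hcov _)) ?_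
  rintro s₁ ⟨hs₁, hcores₁⟩
  rw [hq] at hcores₁
  refine (Ensures.loop (Inv := fun k s' => ∃ l y, k + l.length = m ∧
    FirstPhaseState N F oracle l y s') ?_ m ⟨[], fun _ => 0, by simp, ?_⟩).mono le_rfl ?_
  · rintro k s' ⟨l, y, hk, hst⟩ hb
    have hb' : s'.nat .numCores 0 0 ≠ 0 := hb
    obtain ⟨s'', t, hr, ht, b, y', hst'⟩ := iteration_spec ho hF hcov hst hb'
    -- Selected edges never repeat, so `m` bounds the number of iterations.
    have hlen : (b :: l).length ≤ m := by
      simpa using hst'.run.nodup.length_le_card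
    rw [List.length_cons] at hlen
    exact ⟨k - 1, by omega, s'', t, hr, ht, b :: l, y', by rw [List.length_cons]; omega, hst'⟩
  · refine ⟨.start, hN.of_same hs₁ (by decide) (by decide), ?_, hl.of_same hs₁ (by decide),
      fun e => ?_, by simpa using hcores₁⟩
    · rw [edgeSet_of_same hs₁ (by decide), hq]; rfl
    · rw [hs₁.2 _ (by decide), hload]; simp [Network.load]
  · rintro s' ⟨hb, k, l, y, hk, hst⟩
    have hb' : ¬ ¬ s'.nat .numCores 0 0 = 0 := hb
    rw [not_not, hst.cores.numCores, ho.length_eq_zero_iff] at hb'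
    exact ⟨l, y, hst.run, hb', hst.input, hst.query, hst.order⟩

/-- The list has the newest edge first and the array the oldest first, so lowering the counter pops
the head of the list. -/
theorem OrderIn.tail {e : Fin m} {l : List (Fin m)} {s : Store} (h : OrderIn (e :: l) s) :
    s.nat order l.length 0 = e ∧ OrderIn l (s.setNat count 0 0 l.length) := by
  refine ⟨h.entry_eq _ e ?_, ?_, fun i f hif => ?_⟩
  · simp
  · simp
  · rw [Store.setNat_nat_of_ne _ (by decide)]
    refine h.entry_eq i f ?_
    have hi : i < l.reverse.length := (List.getElem?_eq_some_iff.1 hif).1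
    rwa [List.reverse_cons, List.getElem?_append_left hi]

/-- The memory contains the edge set `I`, and the edges in `l` have yet to be considered by the
second phase, which ends with the edge set `J`. -/
structure SecondPhaseState (N : Network (Fin n) (Fin m)) (F : Finset (Finset (Fin n)))
    (J : Finset (Fin m)) (l : List (Fin m)) (I : Finset (Fin m)) (s : Store) : Prop where
  nodup : l.Nodup
  mem : ∀ e ∈ l, e ∈ I
  result : l.foldl (N.deleteStep F) I = J
  input : N.InputIn s
  query : s.edgeSet m .query = I
  order : OrderIn l s

theorem secondPhase_iteration_spec (ho : N.CoreOracle F oracle) (hF : N.GammaPliable F)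
    (hcov : N.CoversFamily F Finset.univ) {J : Finset (Fin m)} {e : Fin m} {l : List (Fin m)}
    {I : Finset (Fin m)} {s : Store} (h : SecondPhaseState N F J (e :: l) I s) :
    Ensures oracle (.seq (assign count (.sub (.var count) (.const 1)))
      (.seq (.setNat .query (.entry order (.var count)) (.const 0) (.const 0))
        (.seq .askCores
          (.ite (.natEq (.var .numCores) (.const 0)) .skip
            (.setNat .query (.entry order (.var count)) (.const 0) (.const 1))))))
      (1 + (1 + (1 + m + n * n + 2))) s
      (fun s' => ∃ I', SecondPhaseState N F J l I' s') := by
  obtain ⟨hentry, hl⟩ := h.order.tail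
  have hs₁ : SameExcept [count] [] s (s.setNat count 0 0 l.length) :=
    (SameExcept.refl _ _ s).setNat (by decide) _ _ _
  refine Ensures.seq (R := fun s' => s' = s.setNat count 0 0 l.length) (Ensures.setNat ?_) ?_
  · simp [NatExpr.eval, NatExpr.var, h.order.length_eq]
  rintro _ rfl
  have hN₁ := h.input.of_same hs₁ (by decide) (by decide)
  have hq₁ : (s.setNat count 0 0 l.length).edgeSet m .query = I := by
    rw [edgeSet_of_same hs₁ (by decide), h.query]
  have hentry₁ : (s.setNat count 0 0 l.length).nat order l.length 0 = e := by
    rw [hs₁.1 _ (by decide), hentry]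
  clear hs₁
  generalize s.setNat count 0 0 l.length = s₁ at *
  have hs₂ : SameExcept [.query] [] s₁ (s₁.setNat .query e 0 0) :=
    (SameExcept.refl _ _ s₁).setNat (by decide) _ _ _
  refine Ensures.seq (R := fun s' => s' = s₁.setNat .query e 0 0) (Ensures.setNat ?_) ?_
  · simp only [NatExpr.eval_entry, NatExpr.eval_var, NatExpr.eval_const, hl.length_eq, hentry₁]
  rintro _ rfl
  have hq₂ := edgeSet_setNat_zero hq₁ e
  refine Ensures.seq (Ensures.askCores (ho.length_le hF hcov _)) ?_
  rintro s₃ ⟨hs₃, hcores⟩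
  rw [hq₂] at hcores
  have hN₃ := (hN₁.of_same hs₂ (by decide) (by decide)).of_same hs₃ (by decide) (by decide)
  have hl₃ := (hl.of_same hs₂ (by decide)).of_same hs₃ (by decide)
  have hq₃ : s₃.edgeSet m .query = I.erase e := by rw [edgeSet_of_same hs₃ (by decide), hq₂]
  have hentry₃ : s₃.nat order l.length 0 = e := by
    rw [hs₃.1 _ (by decide), hs₂.1 _ (by decide), hentry₁]
  have heI : e ∈ I := h.mem e List.mem_cons_self
  obtain ⟨hel, hnodup⟩ := List.nodup_cons.1 h.nodup
  -- The oracle doubles as the covering test: no residual core means that the set still covers after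
  -- the tentative deletion.
  have htest : s₃.nat .numCores 0 0 = 0 ↔ N.CoversFamily F (I.erase e) := by
    rw [hcores.numCores, ho.length_eq_zero_iff, Network.cores_residual_eq_empty_iff]
  have hres := h.result
  rw [List.foldl_cons] at hres
  refine Ensures.ite (T := 1) (fun hb => Ensures.skip ⟨I.erase e, hnodup, fun f hf => ?_, ?_, hN₃,
    hq₃, hl₃⟩) (fun hb => Ensures.setNat ⟨I, hnodup, fun f hf => ?_, ?_, ?_, ?_, ?_⟩)
  · exact Finset.mem_erase.2 ⟨fun hfe => hel (hfe ▸ hf), h.mem f (List.mem_cons_of_mem _ hf)⟩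
  · rwa [Network.deleteStep, if_pos (htest.1 hb)] at hres
  · exact h.mem f (List.mem_cons_of_mem _ hf)
  · rwa [Network.deleteStep, if_neg (mt htest.2 hb)] at hres
  · exact hN₃.of_same (A := [.query]) (R := [])
      ((SameExcept.refl _ _ s₃).setNat (by decide) _ _ _) (by decide) (by decide)
  · simp only [NatExpr.eval_entry, NatExpr.eval_var, NatExpr.eval_const, hl₃.length_eq, hentry₃]
    rw [edgeSet_setNat_one hq₃, Finset.insert_erase heI]
  · exact hl₃.of_same (A := [.query]) (R := [])
      ((SameExcept.refl _ _ s₃).setNat (by decide) _ _ _) (by decide)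

/-- A bound for the number of steps of the second phase. -/
def secondPhaseTime (n m : ℕ) : ℕ :=
  m * (1 + (1 + (1 + m + n * n + 2)) + 1) + 1

theorem secondPhase_spec (ho : N.CoreOracle F oracle) (hF : N.GammaPliable F)
    (hcov : N.CoversFamily F Finset.univ) {J I : Finset (Fin m)} {l : List (Fin m)} {s : Store}
    (h : SecondPhaseState N F J l I s) :
    Ensures oracle secondPhase (secondPhaseTime n m) s (fun s' =>
      N.InputIn s' ∧ s'.edgeSet m .query = J) := by
  have hlen : l.length ≤ m := by simpa using h.nodup.length_le_card
  refine (Ensures.loop (Inv := fun k s' => ∃ l I, k = l.length ∧ SecondPhaseState N F J l I s')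
    ?_ l.length ⟨l, I, rfl, h⟩).mono (by unfold secondPhaseTime; gcongr) ?_
  · rintro k s' ⟨l', I', rfl, hst⟩ hb
    have hb' : 0 < s'.nat count 0 0 := hb
    rw [hst.order.length_eq] at hb'
    obtain ⟨e, t, rfl⟩ := List.exists_cons_of_length_pos hb'
    exact ⟨t.length, rfl, (secondPhase_iteration_spec ho hF hcov hst).mono le_rfl
      fun s'' ⟨I'', hst''⟩ => ⟨t, I'', rfl, hst''⟩⟩
  · rintro s' ⟨hb, k, l', I', -, hst⟩
    have hb' : ¬ 0 < s'.nat count 0 0 := hb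
    rw [hst.order.length_eq, not_lt, Nat.le_zero, List.length_eq_zero_iff] at hb'
    subst hb'
    exact ⟨hst.input, hst.query.trans hst.result⟩

theorem writeOutput_spec {J : Finset (Fin m)} {s : Store} (hN : N.InputIn s)
    (hq : s.edgeSet m .query = J) :
    Ensures oracle writeOutput (m * (1 + 2) + 2) s (fun s' => s'.edgeSet m .output = J) := by
  refine (Ensures.forLoop (Inv := fun k s' => SameExcept [edgeVar, .output] [] s s' ∧
    ∀ e : Fin m, (e : ℕ) < k → s'.nat .output e 0 = s.nat .query e 0) ?_ ?_ ?_).mono le_rfl ?_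
  · rintro k s' ⟨hs, -⟩
    simpa using (hN.of_same hs (by decide) (by decide)).numEdges
  · exact ⟨(SameExcept.refl _ _ s).setNat (by decide) _ _ _, by simp⟩
  · rintro k hk s' he ⟨hs, hout⟩
    refine Ensures.setNat ⟨?_, (hs.setNat (by decide) _ _ _).setNat (by decide) _ _ _,
      fun f hf => ?_⟩
    · rw [Store.setNat_nat_of_ne _ (by decide), he]
    · rw [Store.setNat_nat_of_ne _ (by decide), Store.setNat_nat_self]
      simp only [NatExpr.eval_var, NatExpr.eval_const, NatExpr.eval_entry, he, and_true]
      split_ifs with hfk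
      · rw [hs.1 _ (by decide), hfk]
      · exact hout f (by omega)
  · rintro s' ⟨-, hout⟩
    rw [← hq]
    ext e
    simp [Store.edgeSet, hout e e.2]

theorem inputIn_initialStore : N.InputIn N.initialStore where
  numEdges := by simp [Network.initialStore]
  tail e := by simp [Network.initialStore]
  head e := by simp [Network.initialStore]
  cost e := by simp [Network.initialStore]

/-- The program carries out a complete run of the algorithm. -/
theorem program_spec (ho : N.CoreOracle F oracle) (hF : N.GammaPliable F)
    (hcov : N.CoversFamily F Finset.univ) :
    Ensures oracle program (firstPhaseTime n m + (secondPhaseTime n m + (m * (1 + 2) + 2)))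
      N.initialStore (fun s' => ∃ y, N.AlgorithmResult F (s'.edgeSet m .output) y) := by
  refine Ensures.seq (firstPhase_spec ho hF hcov inputIn_initialStore ?_ ⟨?_, ?_⟩ ?_) ?_
  · simp [Store.edgeSet, Network.initialStore]
  · simp [Network.initialStore]
  · simp
  · simp [Network.initialStore]
  rintro s₁ ⟨l, y, hrun, hcores, hN₁, hq₁, ho₁⟩
  refine Ensures.seq (secondPhase_spec ho hF hcov (J := N.reverseDelete F l)
    ⟨hrun.nodup, fun e he => List.mem_toFinset.2 he, rfl, hN₁, hq₁, ho₁⟩) ?_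
  rintro s₂ ⟨hN₂, hq₂⟩
  refine (writeOutput_spec hN₂ hq₂).mono le_rfl ?_
  intro s₃ hs₃
  exact ⟨y, l, hrun, hcores, hs₃⟩

/-- A polynomial bound for the number of steps of the program. -/
noncomputable def timeBound : Polynomial ℕ :=
  1 + .X + .X * .X + (.X * (.X * (4 * .X + 10) + 3 +
    (.X * (4 * .X + 4) + 2 + (3 + (1 + .X + .X * .X))) + 1) + 1) +
  (.X * (1 + (1 + (1 + .X + .X * .X + 2)) + 1) + 1 + (.X * (1 + 2) + 2))

theorem time_le_timeBound (n m : ℕ) :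
    firstPhaseTime n m + (secondPhaseTime n m + (m * (1 + 2) + 2)) ≤ timeBound.eval (n + m) := by
  have hn : n ≤ n + m := Nat.le_add_right n m
  have hm : m ≤ n + m := Nat.le_add_left m n
  -- The polynomial is the explicit bound with both sizes replaced by `n + m`; monotonicity in each
  -- size does the rest.
  have e : timeBound.eval (n + m) = firstPhaseTime (n + m) (n + m) +
      (secondPhaseTime (n + m) (n + m) + ((n + m) * (1 + 2) + 2)) := by
    simp only [timeBound, firstPhaseTime, secondPhaseTime, Polynomial.eval_add,
      Polynomial.eval_mul, Polynomial.eval_X, Polynomial.eval_one, Polynomial.eval_ofNat]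
  rw [e]
  generalize n + m = k at *
  unfold firstPhaseTime secondPhaseTime
  gcongr

end PrimalDual

end

end FamilyCover

/-- First part: if the edge set covers the γ-pliable family `F`, every complete run of the
primal-dual algorithm, however ties are broken, ends with a cover of `F` and a feasible dual
solution such that the cost of the cover is at most ten times the dual value, hence at most ten
times the cost of any cover.  Second part: a single program with access to the cores of the residual
families carries out a complete run of the algorithm in polynomial time. -/
theorem theorem1 :
    (∀ (V : Type*) (E : Type*) [Fintype V] [DecidableEq V] [Fintype E] [DecidableEq E]
      (N : FamilyCover.Network V E) (F : Finset (Finset V)),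
      N.GammaPliable F → N.CoversFamily F Finset.univ →
      ∀ (J : Finset E) (y : Finset V → ℝ), N.AlgorithmResult F J y →
        N.CoversFamily F J ∧
        N.DualFeasible F y ∧
        N.totalCost J ≤ 10 * FamilyCover.dualValue F y ∧
        ∀ J' : Finset E, N.CoversFamily F J' → N.totalCost J ≤ 10 * N.totalCost J') ∧
    (∃ (P : FamilyCover.Program) (p : Polynomial ℕ),
      ∀ (n m : ℕ) (N : FamilyCover.Network (Fin n) (Fin m)) (F : Finset (Finset (Fin n)))
        (oracle : Finset (Fin m) → List (Finset (Fin n))),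
        N.GammaPliable F → N.CoversFamily F Finset.univ → N.CoreOracle F oracle →
        ∃ (s : FamilyCover.Store) (t : ℕ) (y : Finset (Fin n) → ℝ),
          FamilyCover.Runs oracle P N.initialStore s t ∧
          t ≤ p.eval (n + m) ∧
          N.AlgorithmResult F (s.edgeSet m .output) y ∧
          N.CoversFamily F (s.edgeSet m .output) ∧
          N.DualFeasible F y ∧
          N.totalCost (s.edgeSet m .output) ≤ 10 * FamilyCover.dualValue F y ∧
          ∀ J' : Finset (Fin m), N.CoversFamily F J' →
            N.totalCost (s.edgeSet m .output) ≤ 10 * N.totalCost J') := by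
  refine ⟨fun V E _ _ _ _ N F hF _ J y h => h.approximation hF,
    FamilyCover.PrimalDual.program, FamilyCover.PrimalDual.timeBound, ?_⟩
  intro n m N F oracle hF hcov ho
  obtain ⟨s, t, hrun, ht, y, hy⟩ := FamilyCover.PrimalDual.program_spec ho hF hcov
  exact ⟨s, t, y, hrun, ht.trans (FamilyCover.PrimalDual.time_le_timeBound n m), hy,
    hy.approximation hF⟩
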